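/- Let $E$ be a finite set. A *packing polytope* is a set $\mathcal P=\{x\in\mathbb R^E_{\ge 0}: Px\le p\}$ with entrywise non-negative $P,p$. A *positive body* is a set $\mathcal K=\{x\in\mathbb R^E_{\ge 0}: Cx\ge c,\ Px\le p\}$, given by finitely many rows with entrywise non-negative $C,c,P,p$; its sparsity is the maximal number of positive entries in a row of $C$, and $\mathcal K^{1-\varepsilon}=\{x\ge 0: Cx\ge(1-\varepsilon)c,\ Px\le p\}$. The recourse of a sequence $x^0=0,x^1,\dots,x^T$ in $\mathbb R^E$ is $\sum_{t=1}^T\|x^t-x^{t-1}\|_1$. A deterministic online algorithm outputs at each time $t\ge 1$ a vector $x^t$ determined by the inputs of times $1,\dots,t$. Write $\log^+ y=\max(0,\log y)$ for $y>0$, and $\log^+0=0$. For $C>0$ and $\varepsilon>0$, a *$(C,\varepsilon)$-positive-body chaser* is a deterministic online algorithm which, given any sequence of non-empty positive bodies $\mathcal K_1,\dots,\mathcal K_T\subseteq\mathbb R^E$, outputs $x^t\in\mathcal K_t^{1-\varepsilon}$ for all $t$, with recourse at most $C\varepsilon^{-1}\log^+(d/\varepsilon)$ times the infimum of the recourse of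 all sequences $y^0=0$, $y^t\in\mathcal K_t$ ($1\le t\le T$), where $d$ is the maximal sparsity of $\mathcal K_1,\dots,\mathcal K_T$. *Fractional submodular objectives chasing.* A packing polytope $\mathcal P\subseteq[0,1]^E$ is given. At each time $t=1,\dots,T$ one is given $E_t\subseteq E$, a non-negative monotone submodular $f_t:2^{E_t}\to\mathbb R$, and a value $0\le V_t\le\max\{f_t(S): S\subseteq E_t,\ \mathbf 1_S\in\mathcal P\}$. With $\mathcal P_t=\{x\in\mathcal P: x_i=0\ \forall i\notin E_t\}$ and $F_t(x)=\sum_{S\subseteq E_t}f_t(S)\prod_{i\in S}x_i\prod_{i\in E_t\setminus S}(1-x_i)$, a deterministic online algorithm is *$\alpha$-approximate and $\beta$-competitive* if it always outputs $x^t\in\mathcal P_t$ with $F_t(x^t)\ge\alpha V_t$ for all $t$, and its recourse (with $x^0=0$) is at most $\beta\cdot OPT_R$, where $OPT_R$ is the minimum of the recourse of $(\mathbf 1_{S_t})_{t=0}^T$ over all $S_0=\emptyset$ and $S_t\subseteq E_t$ with $\mathbf 1_{S_t}\in\mathcal P_t$ and $f_t(S_t)\ge V_t$ ($1\le t\le T$).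 Let $$f_t^*(x)=\min_{S\subseteq E_t}\Big(f_t(S)+\sum_{i\in E_t}\big(f_t(S\cup\{i\})-f_t(S)\big)x_i\Big),\qquad \mathcal K_t=\mathcal P_t\cap\{x\ge 0: f_t^*(x)\ge V_t\}.$$ **Theorem.** There is an absolute constant $C>0$ such that for every finite set $E$ and every $\varepsilon>0$ a $(C,\varepsilon)$-positive-body chaser in $\mathbb R^E$ exists, and for every packing polytope $\mathcal P\subseteq[0,1]^E$ the following hold. 1. Every $\mathcal K_t$ is a non-empty positive body: it is cut out by the rows of $\mathcal P$, the rows $x_i\le 0$ for $i\notin E_t$, and the covering rows $\sum_{i\in E_t}(f_t(S\cup\{i\})-f_t(S))x_i\ge\max(V_t-f_t(S),0)$ for $S\subseteq E_t$. 2. For every $(C,\varepsilon)$-positive-body chaser, the (not necessarily polynomial-time) algorithm that at each time $t$ reveals $\mathcal K_t$, in this form, to the chaser and outputs the vector $x^t$ that it returns is a deterministic $(1-1/e-\varepsilon)$-approximate and $C\varepsilon^{-1}\log^+(\max_t|E_t|/\varepsilon)$-competitive algorithm for fractional submodular objectives chasing. Moreover, $F_t(\mathbf 1-\exp(-x^t))\ge(1-1/e-\varepsilon)V_t$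 for all $t$, where $\mathbf 1-\exp(-x)$ is the vector with coordinates $1-\exp(-x_i)$. -/

import Mathlib

/-! ## Positive bodies -/

/-- A linear constraint with non-negative coefficients and a non-negative right-hand side
(read as `⟨coeff, x⟩ ≥ rhs` for covering and as `⟨coeff, x⟩ ≤ rhs` for packing). -/
structure PosRow (E : Type*) where
  coeff : E → ℝ
  rhs : ℝ
  coeff_nonneg : ∀ i, 0 ≤ coeff i
  rhs_nonneg : 0 ≤ rhs

namespace PosRow

/-- The left-hand side `⟨coeff, x⟩` of a constraint. -/
def lhs {E : Type*} [Fintype E] (r : PosRow E) (x : E → ℝ) : ℝ :=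
  ∑ i, r.coeff i * x i

/-- The number of positive coefficients of a constraint. -/
noncomputable def sparsity {E : Type*} (r : PosRow E) : ℕ :=
  Set.ncard {i | 0 < r.coeff i}

end PosRow

/-- A packing polytope `{x ≥ 0 | P x ≤ p}` with `P, p ≥ 0`, given by its finitely many rows. -/
structure PackingPolytope (E : Type*) where
  rows : Set (PosRow E)
  finite_rows : rows.Finite

/-- The set of points of a packing polytope. -/
def PackingPolytope.carrier {E : Type*} [Fintype E] (P : PackingPolytope E) : Set (E → ℝ) :=
  {x | (∀ i, 0 ≤ x i) ∧ ∀ r ∈ P.rows, r.lhs x ≤ r.rhs}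

/-- A packing-covering polytope (positive body) `{x ≥ 0 | C x ≥ c, P x ≤ p}` with
`C, c, P, p ≥ 0`, given by its finitely many rows. A row whose right-hand side is positive can be
scaled to have right-hand side `1`; packing rows with right-hand side `0` are needed to express
`x i = 0` for the unavailable elements `i`. -/
structure PositiveBody (E : Type*) where
  covering : Set (PosRow E)
  packing : Set (PosRow E)
  finite_covering : covering.Finite
  finite_packing : packing.Finite

namespace PositiveBody

/-- The body with its covering constraints relaxed by the factor `1 - ε`:
`{x ≥ 0 | C x ≥ (1 - ε) c, P x ≤ p}`. -/
def relaxed {E : Type*} [Fintype E] (K : PositiveBody E) (ε : ℝ) : Set (E → ℝ) :=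
  {x | (∀ i, 0 ≤ x i) ∧ (∀ r ∈ K.covering, (1 - ε) * r.rhs ≤ r.lhs x) ∧
    ∀ r ∈ K.packing, r.lhs x ≤ r.rhs}

/-- The set of points of a positive body. -/
def carrier {E : Type*} [Fintype E] (K : PositiveBody E) : Set (E → ℝ) :=
  {x | (∀ i, 0 ≤ x i) ∧ (∀ r ∈ K.covering, r.rhs ≤ r.lhs x) ∧
    ∀ r ∈ K.packing, r.lhs x ≤ r.rhs}

/-- The maximal number of positive coefficients in a covering constraint. -/
noncomputable def sparsity {E : Type*} (K : PositiveBody E) : ℕ :=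
  K.finite_covering.toFinset.sup PosRow.sparsity

end PositiveBody

/-! ## Online algorithms and recourse -/

/-- A deterministic online algorithm with inputs in `α` and outputs in `ℝ^E`: the output at time
`t ≥ 1` is a function of the list of the inputs revealed at times `1, …, t`. -/
abbrev OnlineAlgorithm (α E : Type*) := List α → E → ℝ

/-- The inputs revealed at times `1, …, t`. -/
def history {α : Type*} (I : ℕ → α) (t : ℕ) : List α :=
  (List.range t).map fun s => I (s + 1)

/-- The sequence `x^0 = 0, x^1, x^2, …` that an online algorithm produces on the inputs
`I 1, I 2, …`. -/
def OnlineAlgorithm.run {α E : Type*} (A : OnlineAlgorithm α E) (I : ℕ → α) (t : ℕ) : E → ℝ :=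
  if t = 0 then 0 else A (history I t)

/-- The recourse `∑_{t=1}^T ‖x^t - x^{t-1}‖₁`. -/
def recourse {E : Type*} [Fintype E] (x : ℕ → E → ℝ) (T : ℕ) : ℝ :=
  ∑ t ∈ Finset.range T, ∑ i, |x (t + 1) i - x t i|

/-- The optimal offline recourse for chasing the bodies `K 1, …, K T` from the origin. -/
noncomputable def bodyOptRecourse {E : Type*} [Fintype E] (K : ℕ → PositiveBody E) (T : ℕ) : ℝ :=
  sInf {r | ∃ y : ℕ → E → ℝ, y 0 = 0 ∧ (∀ t ∈ Finset.Icc 1 T, y t ∈ (K t).carrier) ∧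
    r = recourse y T}

/-- The competitive ratio `C ε⁻¹ log (d / ε)`. The positive part of the logarithm only matters
for `ε > 1` (or `d = 0`, where its value is `0`). -/
noncomputable def ratio (C ε : ℝ) (d : ℕ) : ℝ :=
  C * (ε⁻¹ * Real.posLog (d / ε))

/-- `A` is a deterministic online algorithm for chasing positive bodies in `ℝ^E` that satisfies all
packing constraints exactly and all covering constraints up to a factor `1 - ε`, with recourse at
most `C ε⁻¹ log (d / ε)` times the offline optimum, `d` being the maximal row sparsity of the
covering constraints. -/
def IsBodyChaser {E : Type*} [Fintype E] (C ε : ℝ)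
    (A : OnlineAlgorithm (PositiveBody E) E) : Prop :=
  ∀ (T : ℕ) (K : ℕ → PositiveBody E), (∀ t ∈ Finset.Icc 1 T, (K t).carrier.Nonempty) →
    (∀ t ∈ Finset.Icc 1 T, A.run K t ∈ (K t).relaxed ε) ∧
    recourse (A.run K) T ≤
      ratio C ε ((Finset.Icc 1 T).sup fun t => (K t).sparsity) * bodyOptRecourse K T

/-! ## Submodular objectives -/

/-- The characteristic vector of a set. -/
def charVec {E : Type*} [DecidableEq E] (S : Finset E) : E → ℝ :=
  fun i => if i ∈ S then 1 else 0

/-- The multilinear extension of a set function on the subsets of `A`. -/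
noncomputable def multilinearExt {E : Type*} [DecidableEq E] (A : Finset E) (f : Finset E → ℝ)
    (x : E → ℝ) : ℝ :=
  ∑ S ∈ A.powerset, f S * (∏ i ∈ S, x i) * ∏ i ∈ A \ S, (1 - x i)

/-- The coverage (Wolsey) extension of a set function on the subsets of `A`:
the minimum over `S ⊆ A` of `f S + ∑_{i ∈ A} f(i | S) x_i`. -/
noncomputable def coverageExt {E : Type*} [DecidableEq E] (A : Finset E) (f : Finset E → ℝ)
    (x : E → ℝ) : ℝ :=
  A.powerset.inf' (Finset.powerset_nonempty A)
    fun S => f S + ∑ i ∈ A, (f (insert i S) - f S) * x i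

/-- What is revealed at one time step: the available elements `E_t`, a non-negative monotone
submodular function `f_t` on the subsets of `E_t` (values of `f` on other sets are
meaningless and are never used), and the desired value `V_t`. -/
structure StepInput (E : Type*) [DecidableEq E] where
  avail : Finset E
  f : Finset E → ℝ
  V : ℝ
  f_nonneg : ∀ S, S ⊆ avail → 0 ≤ f S
  f_mono : ∀ S U, S ⊆ U → U ⊆ avail → f S ≤ f U
  f_submod : ∀ S U, S ⊆ U → U ⊆ avail → ∀ i ∈ avail, i ∉ U →
    f (insert i U) - f U ≤ f (insert i S) - f S
  V_nonneg : 0 ≤ V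

namespace StepInput

/-- The multilinear extension `F_t` of `f_t`. -/
noncomputable def F {E : Type*} [DecidableEq E] (I : StepInput E) (x : E → ℝ) : ℝ :=
  multilinearExt I.avail I.f x

/-- The coverage extension `f_t^*` of `f_t`. -/
noncomputable def fStar {E : Type*} [DecidableEq E] (I : StepInput E) (x : E → ℝ) : ℝ :=
  coverageExt I.avail I.f x

/-- `P_t`, the points of `P` supported on the available elements. -/
def slice {E : Type*} [Fintype E] [DecidableEq E] (I : StepInput E) (P : PackingPolytope E) :
    Set (E → ℝ) :=
  {x | x ∈ P.carrier ∧ ∀ i, i ∉ I.avail → x i = 0}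

/-- `OPT_t`, the largest value `f_t(S)` of a feasible set `S ⊆ E_t`. -/
noncomputable def optValue {E : Type*} [Fintype E] [DecidableEq E] (I : StepInput E)
    (P : PackingPolytope E) : ℝ :=
  sSup {v | ∃ S, S ⊆ I.avail ∧ charVec S ∈ I.slice P ∧ v = I.f S}

/-- The covering constraint `∑_{i ∈ E_t} f_t(i | S) x_i ≥ V_t - f_t(S)` for `S ⊆ E_t`
(with right-hand side `0` if `f_t(S) ≥ V_t`). -/
noncomputable def wolseyRow {E : Type*} [DecidableEq E] (I : StepInput E)
    (S : {S // S ∈ I.avail.powerset}) : PosRow E where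
  coeff i := if i ∈ I.avail then I.f (insert i S.1) - I.f S.1 else 0
  rhs := max (I.V - I.f S.1) 0
  coeff_nonneg i := by
    have hS : S.1 ⊆ I.avail := Finset.mem_powerset.1 S.2
    split_ifs with h
    · exact sub_nonneg.2 (I.f_mono _ _ (Finset.subset_insert _ _)
        (Finset.insert_subset h hS))
    · exact le_rfl
  rhs_nonneg := le_max_right _ _

/-- The packing constraint `x_i ≤ 0`. -/
def zeroRow {E : Type*} [DecidableEq E] (i : E) : PosRow E where
  coeff j := if j = i then 1 else 0
  rhs := 0
  coeff_nonneg j := by split_ifs <;> norm_num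
  rhs_nonneg := le_rfl

/-- The body `K_t = P_t ∩ {x ≥ 0 | f_t^*(x) ≥ V_t}`, written as a packing-covering polytope. -/
noncomputable def wolseyBody {E : Type*} [Fintype E] [DecidableEq E] (P : PackingPolytope E)
    (I : StepInput E) : PositiveBody E where
  covering := Set.range I.wolseyRow
  packing := P.rows ∪ zeroRow '' {i | i ∉ I.avail}
  finite_covering := Set.finite_range _
  finite_packing := P.finite_rows.union ((Set.toFinite _).image _)

end StepInput

/-! ## Chasing submodular objectives -/

/-- The optimal offline (integral) recourse `OPT_R`: sets `S_t ⊆ E_t`, feasible at time `t` and of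
value at least `V_t`, starting from `S_0 = ∅`. -/
noncomputable def optRecourse {E : Type*} [Fintype E] [DecidableEq E] (P : PackingPolytope E)
    (I : ℕ → StepInput E) (T : ℕ) : ℝ :=
  sInf {r | ∃ S : ℕ → Finset E, S 0 = ∅ ∧
    (∀ t ∈ Finset.Icc 1 T, S t ⊆ (I t).avail ∧ charVec (S t) ∈ (I t).slice P ∧
      (I t).V ≤ (I t).f (S t)) ∧
    r = recourse (fun t => charVec (S t)) T}

/-- Slow chasing of submodular objectives: at every time step, reveal
`K_t = P_t ∩ {x ≥ 0 | f_t^*(x) ≥ V_t}` to the positive body chasing algorithm `A`, and return the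
vector that `A` returns. -/
noncomputable def slowChase {E : Type*} [Fintype E] [DecidableEq E] (P : PackingPolytope E)
    (A : OnlineAlgorithm (PositiveBody E) E) : OnlineAlgorithm (StepInput E) E :=
  fun h => A (h.map (StepInput.wolseyBody P))

/-- The inputs at times `1, …, T` ask for values that are attainable: `V_t ≤ OPT_t`. -/
def IsInstance {E : Type*} [Fintype E] [DecidableEq E] (P : PackingPolytope E)
    (I : ℕ → StepInput E) (T : ℕ) : Prop :=
  ∀ t ∈ Finset.Icc 1 T, (I t).V ≤ (I t).optValue P

/-- The deterministic online algorithm `B` for the fractional submodular objectives chasing problem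
with polytope `P` is feasible and `α`-approximate, with recourse at most `c d` times
the offline optimum, where `d = max_t |E_t|`. -/
def IsFractionalChaser {E : Type*} [Fintype E] [DecidableEq E] (P : PackingPolytope E)
    (α : ℝ) (c : ℕ → ℝ) (B : OnlineAlgorithm (StepInput E) E) : Prop :=
  ∀ (T : ℕ) (I : ℕ → StepInput E), IsInstance P I T →
    (∀ t ∈ Finset.Icc 1 T, B.run I t ∈ (I t).slice P ∧ α * (I t).V ≤ (I t).F (B.run I t)) ∧
    recourse (B.run I) T ≤
      c ((Finset.Icc 1 T).sup fun t => (I t).avail.card) * optRecourse P I T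

/-! The reduction rests on Wolsey's inequality: for monotone submodular `f`, the value `f S` is at
most `f U` plus the marginals at `U` of the elements of `S`. Hence the characteristic vector of
every feasible set of value at least `V` lies in the revealed body
(`StepInput.charVec_mem_wolseyBody`), so the bodies are non-empty and chasing them costs the offline
player at most `optRecourse`. Conversely, if `x` satisfies the covering rows up to `1 - ε`, then
along `s ↦ 1 - exp (-s x)` the multilinear extension grows at rate at least `(1 - ε) V` minus its
value. Integrating over `[0, 1]` gives `(1 - 1/e)(1 - ε) V` at `1 - exp (-x) ≤ x`, and monotonicity
passes this to `x`.

The chaser is analysed with a relative entropy between the online point `x` and the offline point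
`y`, whose dual variable is truncated to `[δ, δ⁻¹]`. Truncation keeps it finite at `x = 0` and makes
it `log δ⁻¹`-Lipschitz in `y`. Small multiplicative updates repair violated rows: a covering update
lowers the potential by at least `η / 2` per unit of increase (`PosRow.exists_cover_step`), and a
packing update only decreases `x` and lowers the potential too (`PosRow.exists_pack_step`). Each
update gains at least a fixed amount, so finitely many suffice. As every move is paid for at all
small `δ`, the level `δ = η / (4 d)` can be fixed in hindsight, without the algorithm knowing the
final sparsity `d`. Scaling the result down makes the packing rows exact. -/

/-! ## The truncated relative entropy -/

/-- The maximizer `u ∈ [δ, δ⁻¹]` of `log u * y - x * (u - 1)`. -/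
noncomputable def truncRatio (δ x y : ℝ) : ℝ :=
  if x ≤ δ * y then δ⁻¹ else max δ (y / x)

/-- The truncated relative entropy: the maximum of `log u * y - x * (u - 1)` over
`u ∈ [δ, δ⁻¹]`. -/
noncomputable def truncEntropy (δ x y : ℝ) : ℝ :=
  Real.log (truncRatio δ x y) * y - x * (truncRatio δ x y - 1)

section TruncEntropy

variable {δ x y : ℝ}

lemma le_truncRatio (hδ : 0 < δ) (hδ1 : δ ≤ 1) : δ ≤ truncRatio δ x y := by
  unfold truncRatio
  split_ifs
  · exact hδ1.trans (one_le_inv_iff₀.2 ⟨hδ, hδ1⟩)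
  · exact le_max_left _ _

lemma truncRatio_pos (hδ : 0 < δ) (hδ1 : δ ≤ 1) : 0 < truncRatio δ x y :=
  hδ.trans_le (le_truncRatio hδ hδ1)

lemma truncRatio_le (hδ : 0 < δ) (hδ1 : δ ≤ 1) (hy : 0 ≤ y) : truncRatio δ x y ≤ δ⁻¹ := by
  unfold truncRatio
  split_ifs with h
  · exact le_rfl
  · have hx : 0 < x := (mul_nonneg hδ.le hy).trans_lt (not_le.1 h)
    refine max_le (hδ1.trans (one_le_inv_iff₀.2 ⟨hδ, hδ1⟩)) ?_
    rw [div_le_iff₀ hx, ← div_eq_inv_mul, le_div_iff₀ hδ]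
    linarith [not_le.1 h]

/-- The function of `u` is concave: `log` lies below its tangent at the maximizer, and `key` is the
first-order optimality condition for `y / x` clamped to the interval. -/
lemma le_truncEntropy (hδ : 0 < δ) (hδ1 : δ ≤ 1) (hy : 0 ≤ y) {u : ℝ} (hu : δ ≤ u)
    (hu' : u ≤ δ⁻¹) : Real.log u * y - x * (u - 1) ≤ truncEntropy δ x y := by
  have hE := truncRatio_pos (x := x) (y := y) hδ hδ1
  have hu0 : 0 < u := hδ.trans_le hu
  have hlog : Real.log u - Real.log (truncRatio δ x y) ≤ u / truncRatio δ x y - 1 := by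
    rw [← Real.log_div hu0.ne' hE.ne']
    exact Real.log_le_sub_one_of_pos (div_pos hu0 hE)
  have key : (u - truncRatio δ x y) * (y - x * truncRatio δ x y) ≤ 0 := by
    unfold truncRatio
    split_ifs with h
    · refine mul_nonpos_of_nonpos_of_nonneg (by linarith) ?_
      rw [sub_nonneg, ← div_eq_mul_inv, div_le_iff₀ hδ]
      linarith
    · have hx : 0 < x := (mul_nonneg hδ.le hy).trans_lt (not_le.1 h)
      rcases le_total δ (y / x) with h1 | h1
      · rw [max_eq_right h1, mul_div_cancel₀ _ hx.ne']
        simp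
      · rw [max_eq_left h1]
        rw [div_le_iff₀ hx] at h1
        exact mul_nonpos_of_nonneg_of_nonpos (by linarith) (by linarith)
  have h2 : (u / truncRatio δ x y - 1) * y - x * (u - truncRatio δ x y) ≤ 0 := by
    have : (u / truncRatio δ x y - 1) * y - x * (u - truncRatio δ x y)
        = (u - truncRatio δ x y) * (y - x * truncRatio δ x y) / truncRatio δ x y := by
      field_simp
    rw [this]
    exact div_nonpos_of_nonpos_of_nonneg key hE.le
  have h3 := mul_le_mul_of_nonneg_right hlog hy
  unfold truncEntropy
  linarith

lemma truncEntropy_nonneg (hδ : 0 < δ) (hδ1 : δ ≤ 1) (hy : 0 ≤ y) : 0 ≤ truncEntropy δ x y := by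
  simpa using le_truncEntropy (x := x) hδ hδ1 hy hδ1 (one_le_inv_iff₀.2 ⟨hδ, hδ1⟩)

lemma truncEntropy_zero_zero : truncEntropy δ 0 0 = 0 := by simp [truncEntropy]

/-- The entropy is a maximum of functions affine in `y` with slopes `log u`, and `|log u| ≤ log δ⁻¹`
on the truncation interval. This is the price of an offline move. -/
lemma truncEntropy_le_add_abs (hδ : 0 < δ) (hδ1 : δ ≤ 1) (hy : 0 ≤ y) {y' : ℝ} (hy' : 0 ≤ y') :
    truncEntropy δ x y' ≤ truncEntropy δ x y + Real.log δ⁻¹ * |y' - y| := by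
  have h1 := le_truncEntropy (x := x) hδ hδ1 hy (le_truncRatio (x := x) (y := y') hδ hδ1)
    (truncRatio_le hδ hδ1 hy')
  have hE := truncRatio_pos (x := x) (y := y') hδ hδ1
  have h2 : |Real.log (truncRatio δ x y')| ≤ Real.log δ⁻¹ := by
    rw [abs_le]
    constructor
    · rw [Real.log_inv, neg_neg]
      exact Real.log_le_log hδ (le_truncRatio hδ hδ1)
    · exact Real.log_le_log hE (truncRatio_le hδ hδ1 hy')
  have h3 : Real.log (truncRatio δ x y') * (y' - y) ≤ Real.log δ⁻¹ * |y' - y| :=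
    (le_abs_self _).trans (by
      rw [abs_mul]
      exact mul_le_mul_of_nonneg_right h2 (abs_nonneg _))
  have h4 : truncEntropy δ x y' = Real.log (truncRatio δ x y') * y' -
    x * (truncRatio δ x y' - 1) := rfl
  linarith

/-- Convexity in `x`: `1 - truncRatio` is a slope at the new point `x'`, so the maximizer for `x'`
is tested at `x`. -/
lemma truncEntropy_le_add (hδ : 0 < δ) (hδ1 : δ ≤ 1) (hy : 0 ≤ y) (x' : ℝ) :
    truncEntropy δ x' y ≤ truncEntropy δ x y + (x' - x) * (1 - truncRatio δ x' y) := by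
  have h1 := le_truncEntropy (x := x) hδ hδ1 hy (le_truncRatio (x := x') (y := y) hδ hδ1)
    (truncRatio_le hδ hδ1 hy)
  have h4 : truncEntropy δ x' y = Real.log (truncRatio δ x' y) * y -
    x' * (truncRatio δ x' y - 1) := rfl
  linarith

lemma mul_truncRatio_le (hδ : 0 < δ) (hx : 0 ≤ x) (hy : 0 ≤ y) :
    x * truncRatio δ x y ≤ y + δ * x := by
  unfold truncRatio
  split_ifs with h
  · rw [← div_eq_mul_inv]
    have : x / δ ≤ y := by rw [div_le_iff₀ hδ]; linarith
    nlinarith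
  · have hx : 0 < x := (mul_nonneg hδ.le hy).trans_lt (not_le.1 h)
    rw [mul_max_of_nonneg _ _ hx.le, mul_div_cancel₀ _ hx.ne']
    exact max_le (by linarith) (by nlinarith)

/-- Gain of one coordinate in a covering update. If the ratio is truncated at `δ⁻¹`, the additive
term `a ≥ δ` alone gives a gain of `s`. Otherwise the ratio is at least `y / x'`, and `c * s ≤ τ`
makes the rate at `x'` at most `1 + τ` times the rate at `x`. -/
lemma min_mul_le_mul_truncRatio (hδ : 0 < δ) (hy : 0 ≤ y) (hx : 0 ≤ x) {a c s τ : ℝ}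
    (ha : δ ≤ a) (hc : 0 ≤ c) (hs : 0 < s) (hτ : c * s ≤ τ) :
    min (c * y) 1 * s ≤
      (1 + τ) * (s * (c * x + a) * truncRatio δ (x + s * (c * x + a)) y) := by
  have ha0 : 0 < a := hδ.trans_le ha
  have hτ0 : 0 ≤ τ := (mul_nonneg hc hs.le).trans hτ
  have hw : 0 < c * x + a := by positivity
  set x' := x + s * (c * x + a) with hx'
  have hx'0 : 0 < x' := by positivity
  have h0 : 0 < s * (c * x + a) := by positivity
  rcases le_or_gt x' (δ * y) with h | h
  · have hE : truncRatio δ x' y = δ⁻¹ := if_pos h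
    rw [hE]
    have h1 : 1 ≤ (c * x + a) * δ⁻¹ := by
      rw [← div_eq_mul_inv, le_div_iff₀ hδ]
      nlinarith [mul_nonneg hc hx]
    calc min (c * y) 1 * s ≤ 1 * s := by gcongr; exact min_le_right _ _
      _ ≤ (1 + τ) * (s * ((c * x + a) * δ⁻¹)) := by
          have : s * 1 ≤ s * ((c * x + a) * δ⁻¹) := by gcongr
          nlinarith
      _ = _ := by ring
  · have hE : y / x' ≤ truncRatio δ x' y := by
      unfold truncRatio
      rw [if_neg (not_le.2 h)]
      exact le_max_right _ _
    have h1 : c * x' ≤ (1 + τ) * (c * x + a) := by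
      rw [hx']
      nlinarith
    calc min (c * y) 1 * s ≤ (c * y) * s := by gcongr; exact min_le_left _ _
      _ = (c * x') * (y * s / x') := by field_simp
      _ ≤ ((1 + τ) * (c * x + a)) * (y * s / x') := by gcongr
      _ = (1 + τ) * (s * (c * x + a) * (y / x')) := by ring
      _ ≤ _ := by gcongr

end TruncEntropy

/-! ## Single steps towards a positive body -/

/-- The potential of the online solution `x` against the offline solution `y`. -/
noncomputable def potential {E : Type*} [Fintype E] (δ : ℝ) (x y : E → ℝ) : ℝ :=
  ∑ i, truncEntropy δ (x i) (y i)

/-- The total increase of the coordinates from `x` to `x'`. -/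
noncomputable def increase {E : Type*} [Fintype E] (x x' : E → ℝ) : ℝ :=
  ∑ i, max (x' i - x i) 0

section Steps

variable {E : Type*} [Fintype E]

lemma potential_nonneg {δ : ℝ} (hδ : 0 < δ) (hδ1 : δ ≤ 1) {x y : E → ℝ} (hy : ∀ i, 0 ≤ y i) :
    0 ≤ potential δ x y :=
  Finset.sum_nonneg fun i _ => truncEntropy_nonneg hδ hδ1 (hy i)

lemma potential_zero_zero {δ : ℝ} : potential δ (0 : E → ℝ) 0 = 0 := by
  simp [potential, truncEntropy_zero_zero]

lemma increase_triangle (x x' x'' : E → ℝ) : increase x x'' ≤ increase x x' + increase x' x'' := by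
  unfold increase
  rw [← Finset.sum_add_distrib]
  refine Finset.sum_le_sum fun i _ => max_le ?_ ?_
  · linarith [le_max_left (x' i - x i) 0, le_max_left (x'' i - x' i) 0]
  · linarith [le_max_right (x' i - x i) 0, le_max_right (x'' i - x' i) 0]

/-- Truncation caps the guaranteed gain of each coordinate; a row covered by `y` keeps its full
total gain under this cap. -/
lemma one_le_sum_min_one {ι : Type*} {S : Finset ι} {v : ι → ℝ} (hv : ∀ i ∈ S, 0 ≤ v i)
    (h : 1 ≤ ∑ i ∈ S, v i) : 1 ≤ ∑ i ∈ S, min (v i) 1 := by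
  by_cases h1 : ∃ i ∈ S, 1 ≤ v i
  · obtain ⟨i, hi, h1⟩ := h1
    calc (1 : ℝ) = min (v i) 1 := (min_eq_right h1).symm
      _ ≤ _ := Finset.single_le_sum (f := fun i => min (v i) 1)
        (fun j hj => le_min (hv j hj) zero_le_one) hi
  · push Not at h1
    rwa [Finset.sum_congr rfl fun i hi => min_eq_left (h1 i hi).le]

lemma PosRow.lhs_nonneg (r : PosRow E) {x : E → ℝ} (hx : ∀ i, 0 ≤ x i) : 0 ≤ r.lhs x :=
  Finset.sum_nonneg fun i _ => mul_nonneg (r.coeff_nonneg i) (hx i)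

/-- A violated covering constraint can be worked on by a multiplicative increase that decreases
the potential by an amount bounded below. -/
lemma PosRow.exists_cover_step (r : PosRow E) (hr : 0 < r.rhs) {η : ℝ} (hη : 0 < η)
    {n : ℕ} (hn : r.sparsity ≤ n) (hn1 : 1 ≤ n) (Z : Set E) :
    ∃ γ > 0, ∀ x : E → ℝ, (∀ i, 0 ≤ x i) → r.lhs x < (1 - η) * r.rhs →
      ∃ x' : E → ℝ, (∀ i, 0 ≤ x' i) ∧ (∀ i ∈ Z, x' i = x i) ∧
        ∀ δ, 0 < δ → δ ≤ 1 → δ ≤ η / (4 * n) → ∀ y : E → ℝ, (∀ i, 0 ≤ y i) → (∀ i ∈ Z, y i = 0) →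
          r.rhs ≤ r.lhs y →
          potential δ x' y + η / 2 * increase x x' ≤ potential δ x y ∧
          potential δ x' y + γ ≤ potential δ x y := by
  classical
  set c : E → ℝ := fun i => r.coeff i / r.rhs with hc
  have hc0 : ∀ i, 0 ≤ c i := fun i => div_nonneg (r.coeff_nonneg i) hr.le
  set M : ℝ := ∑ i, c i + 1 with hM
  have hcM : ∀ i, c i ≤ M := fun i => by
    have := Finset.single_le_sum (f := c) (fun j _ => hc0 j) (Finset.mem_univ i)
    linarith
  have hM0 : 0 < M := by
    have := Finset.sum_nonneg (s := Finset.univ) fun i _ => hc0 i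
    linarith
  set τ : ℝ := η / 4 with hτ
  -- `M` dominates all normalized coefficients and is positive even for an empty index set, so `c i
  -- * s ≤ τ` for every `i`.
  set s : ℝ := τ / M with hs
  have hs0 : 0 < s := by positivity
  have hcs : ∀ i, c i * s ≤ τ := fun i => by
    have h1 : c i * s ≤ M * s := mul_le_mul_of_nonneg_right (hcM i) hs0.le
    have h2 : M * s = τ := mul_div_cancel₀ _ hM0.ne'
    linarith
  have hn0 : (0 : ℝ) < n := by exact_mod_cast hn1
  -- The additive part lets zero coordinates grow. Over at most `n` coordinates it totals at most `η
  -- / 4`, a quarter of the violation `η`, which forces `δ ≤ η / (4 n)`.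
  set a : ℝ := η / (4 * n) with ha
  have ha0 : 0 < a := by positivity
  set S : Finset E := Finset.univ.filter fun i => 0 < r.coeff i ∧ i ∉ Z with hS
  have hScard : (S.card : ℝ) ≤ n := by
    have h1 : S.card ≤ r.sparsity := by
      unfold PosRow.sparsity
      rw [← Set.ncard_coe_finset]
      refine Set.ncard_le_ncard (fun i hi => ?_) (Set.toFinite _)
      simp only [hS, Finset.coe_filter, Finset.mem_univ, true_and, Set.mem_ofPred_eq] at hi
      exact hi.1
    exact_mod_cast h1.trans hn
  have hlhs : ∀ z : E → ℝ, r.lhs z = r.rhs * ∑ i, c i * z i := fun z => by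
    unfold PosRow.lhs
    rw [Finset.mul_sum]
    refine Finset.sum_congr rfl fun i _ => ?_
    simp only [hc]
    field_simp
  refine ⟨η / 2 * s, by positivity, fun x hx hviol => ?_⟩
  set w : E → ℝ := fun i => if i ∈ S then s * (c i * x i + a) else 0 with hw
  have hw0 : ∀ i, 0 ≤ w i := fun i => by
    simp only [hw]
    split_ifs
    · have := mul_nonneg (hc0 i) (hx i)
      positivity
    · exact le_rfl
  have hwsum : ∑ i, w i ≤ s * (1 - η + η / 4) := by
    have h1 : ∑ i, w i = s * (∑ i ∈ S, c i * x i + S.card * a) := by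
      simp only [hw]
      rw [Finset.sum_ite_mem, Finset.univ_inter, ← Finset.mul_sum, Finset.sum_add_distrib]
      simp
    have h2 : ∑ i ∈ S, c i * x i ≤ ∑ i, c i * x i :=
      Finset.sum_le_sum_of_subset_of_nonneg (Finset.subset_univ _)
        fun i _ _ => mul_nonneg (hc0 i) (hx i)
    have h3 : ∑ i, c i * x i ≤ 1 - η := by
      rw [hlhs] at hviol
      by_contra hcon
      nlinarith [not_le.1 hcon]
    have h4 : S.card * a ≤ η / 4 := by
      calc S.card * a ≤ n * a := by gcongr
        _ = η / 4 := by rw [ha]; field_simp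
    rw [h1]
    gcongr
    linarith
  have hinc : increase x (fun i => x i + w i) = ∑ i, w i := by
    unfold increase
    refine Finset.sum_congr rfl fun i _ => ?_
    rw [add_sub_cancel_left, max_eq_left (hw0 i)]
  refine ⟨fun i => x i + w i, fun i => add_nonneg (hx i) (hw0 i), fun i hi => ?_,
    fun δ hδ hδ1 hδa y hy hyZ hyr => ?_⟩
  · have : i ∉ S := by simp [hS, hi]
    simp [hw, this]
  have hpot : potential δ (fun i => x i + w i) y ≤ potential δ x y +
      (∑ i, w i - ∑ i, w i * truncRatio δ (x i + w i) (y i)) := by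
    unfold potential
    rw [← Finset.sum_sub_distrib, ← Finset.sum_add_distrib]
    refine Finset.sum_le_sum fun i _ => ?_
    have := truncEntropy_le_add (x := x i) hδ hδ1 (hy i) (x i + w i)
    linarith
  have hgain : s ≤ (1 + τ) * ∑ i, w i * truncRatio δ (x i + w i) (y i) := by
    have h1 : 1 ≤ ∑ i ∈ S, c i * y i := by
      have h2 : ∑ i ∈ S, c i * y i = ∑ i, c i * y i := by
        refine Finset.sum_subset (Finset.subset_univ _) fun i _ hi => ?_
        simp only [hS, Finset.mem_filter, Finset.mem_univ, true_and, not_and, not_not] at hi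
        rcases (r.coeff_nonneg i).eq_or_lt with h3 | h3
        · simp [hc, ← h3]
        · simp [hyZ i (hi h3)]
      rw [h2]
      rw [hlhs] at hyr
      by_contra hcon
      nlinarith [not_le.1 hcon]
    have h2 := one_le_sum_min_one (fun i _ => mul_nonneg (hc0 i) (hy i)) h1
    have h3 : ∑ i, w i * truncRatio δ (x i + w i) (y i) =
        ∑ i ∈ S, s * (c i * x i + a) * truncRatio δ (x i + s * (c i * x i + a)) (y i) := by
      rw [← Finset.sum_subset (Finset.subset_univ S)]
      · refine Finset.sum_congr rfl fun i hi => ?_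
        simp only [hw, if_pos hi]
      · intro i _ hi
        simp only [hw, if_neg hi, zero_mul]
    rw [h3, Finset.mul_sum]
    calc s ≤ (∑ i ∈ S, min (c i * y i) 1) * s := by nlinarith
      _ = ∑ i ∈ S, min (c i * y i) 1 * s := Finset.sum_mul _ _ _
      _ ≤ _ := Finset.sum_le_sum fun i _ =>
        min_mul_le_mul_truncRatio hδ (hy i) (hx i) hδa (hc0 i) hs0 (hcs i)
  have hgain' : (1 - τ) * s ≤ ∑ i, w i * truncRatio δ (x i + w i) (y i) := by
    have hτ0 : 0 < τ := by positivity
    set G := ∑ i, w i * truncRatio δ (x i + w i) (y i)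
    by_contra hcon
    nlinarith [not_le.1 hcon, mul_pos hs0 (mul_pos hτ0 hτ0)]
  -- The update adds at most `(1 - 3η/4) s` and gains at least `(1 - η/4) s`. The net decrease `η s
  -- / 2` also pays for the increase, which is at most `s`.
  have hdec : potential δ (fun i => x i + w i) y + η / 2 * s ≤ potential δ x y := by
    have : s * (1 - η + η / 4) - (1 - τ) * s = - (η / 2 * s) := by rw [hτ]; ring
    linarith
  refine ⟨?_, hdec⟩
  rw [hinc]
  have : ∑ i, w i ≤ s := by nlinarith
  nlinarith

/-- A violated packing constraint can be worked on by a multiplicative decrease that decreases the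
potential by an amount bounded below. -/
lemma PosRow.exists_pack_step (r : PosRow E) (hr : 0 < r.rhs) {η : ℝ} (hη : 0 < η)
    (hη1 : η ≤ 1 / 2) :
    ∃ γ > 0, ∀ x : E → ℝ, (∀ i, 0 ≤ x i) → (1 + η) * r.rhs < r.lhs x →
      ∃ x' : E → ℝ, (∀ i, 0 ≤ x' i) ∧ (∀ i, x' i ≤ x i) ∧
        ∀ δ, 0 < δ → δ ≤ η / 4 → ∀ y : E → ℝ, (∀ i, 0 ≤ y i) → r.lhs y ≤ r.rhs →
          potential δ x' y + γ ≤ potential δ x y := by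
  set p : E → ℝ := fun i => r.coeff i / r.rhs with hp
  have hp0 : ∀ i, 0 ≤ p i := fun i => div_nonneg (r.coeff_nonneg i) hr.le
  set M : ℝ := ∑ i, p i + 1 with hM
  have hpM : ∀ i, p i ≤ M := fun i => by
    have := Finset.single_le_sum (f := p) (fun j _ => hp0 j) (Finset.mem_univ i)
    linarith
  have hM0 : 0 < M := by
    have := Finset.sum_nonneg (s := Finset.univ) fun i _ => hp0 i
    linarith
  set τ : ℝ := η / 4 with hτ
  set s : ℝ := τ / M with hs
  have hs0 : 0 < s := by positivity
  have hps : ∀ i, p i * s ≤ τ := fun i => by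
    have h1 : p i * s ≤ M * s := mul_le_mul_of_nonneg_right (hpM i) hs0.le
    have h2 : M * s = τ := mul_div_cancel₀ _ hM0.ne'
    linarith
  have hlhs : ∀ z : E → ℝ, r.lhs z = r.rhs * ∑ i, p i * z i := fun z => by
    unfold PosRow.lhs
    rw [Finset.mul_sum]
    refine Finset.sum_congr rfl fun i _ => ?_
    simp only [hp]
    field_simp
  refine ⟨η / 8 * s, by positivity, fun x hx hviol => ?_⟩
  have hx' : ∀ i, 0 ≤ x i * (1 - p i * s) := fun i =>
    mul_nonneg (hx i) (by linarith [hps i])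
  refine ⟨fun i => x i * (1 - p i * s), hx', fun i => ?_, fun δ hδ hδη y hy hyr => ?_⟩
  · have := mul_nonneg (hx i) (mul_nonneg (hp0 i) hs0.le)
    linarith
  have hδ1 : δ ≤ 1 := by linarith
  set X := ∑ i, p i * x i with hX
  have hX1 : 1 + η ≤ X := by
    rw [hlhs] at hviol
    by_contra hcon
    nlinarith [not_le.1 hcon]
  have hY1 : ∑ i, p i * y i ≤ 1 := by
    rw [hlhs] at hyr
    by_contra hcon
    nlinarith [not_le.1 hcon]
  -- Multiplying by `1 - τ` replaces the new coordinate by the old one, since `x' i = x i * (1 - p i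
  -- * s) ≥ (1 - τ) * x i`.
  have hcoord : ∀ i, (1 - τ) * (truncEntropy δ (x i * (1 - p i * s)) (y i) -
      truncEntropy δ (x i) (y i)) ≤ s * (p i * y i + δ * (p i * x i) - (1 - τ) * (p i * x i)) := by
    intro i
    have h1 := truncEntropy_le_add (x := x i) hδ hδ1 (hy i) (x i * (1 - p i * s))
    have h2 := mul_truncRatio_le hδ (hx' i) (hy i)
    set R := truncRatio δ (x i * (1 - p i * s)) (y i)
    have hR : 0 < R := truncRatio_pos hδ hδ1
    have h3 : (1 - τ) * (x i * R) ≤ y i + δ * x i := by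
      have h4 : (1 - τ) * (x i * R) ≤ (1 - p i * s) * (x i * R) :=
        mul_le_mul_of_nonneg_right (by linarith [hps i]) (mul_nonneg (hx i) hR.le)
      have h5 : δ * (x i * (1 - p i * s)) ≤ δ * x i := by
        have := mul_nonneg hδ.le (mul_nonneg (hx i) (mul_nonneg (hp0 i) hs0.le))
        linarith
      linarith
    have h6 : (1 - τ) * (truncEntropy δ (x i * (1 - p i * s)) (y i) -
      truncEntropy δ (x i) (y i)) ≤ (1 - τ) * ((x i * (1 - p i * s) - x i) * (1 - R)) :=
      mul_le_mul_of_nonneg_left (by linarith) (by linarith)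
    have h7 := mul_le_mul_of_nonneg_left h3 (mul_nonneg (hp0 i) hs0.le)
    linarith
  have hsum : (1 - τ) * (potential δ (fun i => x i * (1 - p i * s)) y - potential δ x y) ≤
      s * (1 + δ * X - (1 - τ) * X) := by
    calc (1 - τ) * (potential δ (fun i => x i * (1 - p i * s)) y - potential δ x y)
        = ∑ i, (1 - τ) * (truncEntropy δ (x i * (1 - p i * s)) (y i) -
            truncEntropy δ (x i) (y i)) := by
          unfold potential
          rw [← Finset.sum_sub_distrib, Finset.mul_sum]
      _ ≤ ∑ i, s * (p i * y i + δ * (p i * x i) - (1 - τ) * (p i * x i)) :=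
          Finset.sum_le_sum fun i _ => hcoord i
      _ = s * (∑ i, p i * y i + δ * X - (1 - τ) * X) := by
          rw [← Finset.mul_sum, Finset.sum_sub_distrib, Finset.sum_add_distrib, ← Finset.mul_sum,
            ← Finset.mul_sum]
      _ ≤ _ := by gcongr
  -- Both `δ` and `τ` are at most `η / 4`, so the left side is at most `1 - (1 - η/2)(1 + η)`; `η ≤
  -- 1/2` is what makes this at most `-η / 4`.
  have hX2 : 1 + δ * X - (1 - τ) * X ≤ -(η / 4) := by
    have h1 : δ * X ≤ η / 4 * X := mul_le_mul_of_nonneg_right hδη (by linarith)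
    have h2 : (1 - η / 2) * (1 + η) ≤ (1 - η / 2) * X :=
      mul_le_mul_of_nonneg_left hX1 (by linarith)
    nlinarith
  have h8 : s * (1 + δ * X - (1 - τ) * X) ≤ s * (-(η / 4)) :=
    mul_le_mul_of_nonneg_left hX2 hs0.le
  by_contra hcon
  have h9 := not_le.1 hcon
  have h10 : (1 - τ) * (-(η / 8 * s)) ≤
      (1 - τ) * (potential δ (fun i => x i * (1 - p i * s)) y - potential δ x y) :=
    mul_le_mul_of_nonneg_left (by linarith) (by linarith)
  have h11 : 0 < η * s := by positivity
  nlinarith [mul_pos hη h11]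

end Steps

/-! ## The multilinear extension -/

section Multilinear

variable {E : Type*} [DecidableEq E]

lemma multilinearExt_empty (f : Finset E → ℝ) (x : E → ℝ) : multilinearExt ∅ f x = f ∅ := by
  simp [multilinearExt]

/-- Condition on whether `a` belongs to the random set. This recursion drives the inductions on the
ground set. -/
lemma multilinearExt_insert {A : Finset E} {a : E} (ha : a ∉ A) (f : Finset E → ℝ) (x : E → ℝ) :
    multilinearExt (insert a A) f x =
      x a * multilinearExt A (fun S => f (insert a S)) x + (1 - x a) * multilinearExt A f x := by
  unfold multilinearExt
  rw [Finset.sum_powerset_insert ha, add_comm, Finset.mul_sum, Finset.mul_sum]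
  congr 1
  · refine Finset.sum_congr rfl fun S hS => ?_
    have haS : a ∉ S := fun h => ha (Finset.mem_powerset.1 hS h)
    rw [Finset.prod_insert haS, Finset.insert_sdiff_insert,
      Finset.sdiff_insert_of_notMem ha]
    ring
  · refine Finset.sum_congr rfl fun S hS => ?_
    have haS : a ∉ S := fun h => ha (Finset.mem_powerset.1 hS h)
    rw [Finset.insert_sdiff_of_notMem _ haS, Finset.prod_insert (by simp [ha])]
    ring

lemma multilinearExt_add (A : Finset E) (f g : Finset E → ℝ) (x : E → ℝ) :
    multilinearExt A (fun S => f S + g S) x = multilinearExt A f x + multilinearExt A g x := by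
  simp only [multilinearExt, add_mul, Finset.sum_add_distrib]

lemma multilinearExt_sub (A : Finset E) (f g : Finset E → ℝ) (x : E → ℝ) :
    multilinearExt A (fun S => f S - g S) x = multilinearExt A f x - multilinearExt A g x := by
  simp only [multilinearExt, sub_mul, Finset.sum_sub_distrib]

lemma multilinearExt_const_mul (A : Finset E) (c : ℝ) (f : Finset E → ℝ) (x : E → ℝ) :
    multilinearExt A (fun S => c * f S) x = c * multilinearExt A f x := by
  simp only [multilinearExt, Finset.mul_sum, mul_assoc]

lemma multilinearExt_const (A : Finset E) (c : ℝ) (x : E → ℝ) :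
    multilinearExt A (fun _ => c) x = c := by
  induction A using Finset.induction_on with
  | empty => simp [multilinearExt_empty]
  | insert a A ha ih => rw [multilinearExt_insert ha, ih]; ring

lemma multilinearExt_mono_fun {A : Finset E} {f g : Finset E → ℝ} {x : E → ℝ}
    (hx : ∀ i, 0 ≤ x i) (hx1 : ∀ i, x i ≤ 1) (h : ∀ S ⊆ A, f S ≤ g S) :
    multilinearExt A f x ≤ multilinearExt A g x := by
  refine Finset.sum_le_sum fun S hS => ?_
  have h1 : 0 ≤ ∏ i ∈ S, x i := Finset.prod_nonneg fun i _ => hx i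
  have h2 : 0 ≤ ∏ i ∈ A \ S, (1 - x i) := Finset.prod_nonneg fun i _ => by linarith [hx1 i]
  have h3 := h S (Finset.mem_powerset.1 hS)
  gcongr

lemma multilinearExt_nonneg {A : Finset E} {f : Finset E → ℝ} {x : E → ℝ}
    (hx : ∀ i, 0 ≤ x i) (hx1 : ∀ i, x i ≤ 1) (h : ∀ S ⊆ A, 0 ≤ f S) :
    0 ≤ multilinearExt A f x := by
  simpa [multilinearExt_const] using multilinearExt_mono_fun (f := fun _ => 0) hx hx1 h

lemma multilinearExt_mono {A : Finset E} {f : Finset E → ℝ} {x y : E → ℝ}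
    (hx : ∀ i, 0 ≤ x i) (hxy : ∀ i, x i ≤ y i) (hy : ∀ i, y i ≤ 1)
    (hf : ∀ S U, S ⊆ U → U ⊆ A → f S ≤ f U) :
    multilinearExt A f x ≤ multilinearExt A f y := by
  induction A using Finset.induction_on generalizing f with
  | empty => simp [multilinearExt_empty]
  | insert a A ha ih =>
    rw [multilinearExt_insert ha, multilinearExt_insert ha]
    have h1 := ih (f := f) fun S U hSU hU => hf S U hSU (hU.trans (Finset.subset_insert _ _))
    have h2 := ih (f := fun S => f (insert a S)) fun S U hSU hU =>
      hf _ _ (Finset.insert_subset_insert _ hSU) (Finset.insert_subset_insert _ hU)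
    have h3 : multilinearExt A f x ≤ multilinearExt A (fun S => f (insert a S)) x :=
      multilinearExt_mono_fun hx (fun i => (hxy i).trans (hy i)) fun S hS =>
        hf _ _ (Finset.subset_insert _ _) (Finset.insert_subset_insert _ hS)
    have hya : 0 ≤ y a := (hx a).trans (hxy a)
    nlinarith [mul_le_mul_of_nonneg_left h1 (sub_nonneg.2 (hy a)),
      mul_le_mul_of_nonneg_left h2 hya,
      mul_le_mul_of_nonneg_left h3 (sub_nonneg.2 (hxy a))]

/-- The derivative of the multilinear extension along `s ↦ 1 - exp (-s x)`. -/
lemma hasDerivAt_multilinearExt (A : Finset E) (f : Finset E → ℝ) (x : E → ℝ) (s : ℝ) :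
    HasDerivAt (fun s : ℝ => multilinearExt A f (fun i => 1 - Real.exp (-(s * x i))))
      (multilinearExt A (fun S => ∑ i ∈ A, (f (insert i S) - f S) * x i)
        (fun i => 1 - Real.exp (-(s * x i)))) s := by
  induction A using Finset.induction_on generalizing f with
  | empty => simpa [multilinearExt_empty] using hasDerivAt_const s (f ∅)
  | insert a A ha ih =>
    have he : HasDerivAt (fun s : ℝ => Real.exp (-(s * x a)))
        (Real.exp (-(s * x a)) * (-(1 * x a))) s :=
      (((hasDerivAt_id s).mul_const (x a)).neg).exp
    have h := ((he.const_sub 1).mul (ih fun S => f (insert a S))).add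
      ((he.const_sub 1).const_sub 1 |>.mul (ih f))
    have hfun : (fun s : ℝ => multilinearExt (insert a A) f (fun i => 1 - Real.exp (-(s * x i)))) =
        fun s : ℝ => (1 - Real.exp (-(s * x a))) *
          multilinearExt A (fun S => f (insert a S)) (fun i => 1 - Real.exp (-(s * x i))) +
          (1 - (1 - Real.exp (-(s * x a)))) *
          multilinearExt A f (fun i => 1 - Real.exp (-(s * x i))) := by
      funext s
      rw [multilinearExt_insert ha]
    rw [hfun]
    refine h.congr_deriv ?_
    rw [multilinearExt_insert ha]
    -- Once `a` is in the set its marginal is zero, so only the branch without `a` contributes the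
    -- term of `a`.
    have h1 : (fun S => ∑ i ∈ insert a A, (f (insert i (insert a S)) - f (insert a S)) * x i) =
        fun S => ∑ i ∈ A, (f (insert a (insert i S)) - f (insert a S)) * x i := by
      funext S
      rw [Finset.sum_insert ha, Finset.insert_idem, sub_self, zero_mul, zero_add]
      exact Finset.sum_congr rfl fun i _ => by rw [Finset.insert_comm]
    have h2 : (fun S => ∑ i ∈ insert a A, (f (insert i S) - f S) * x i) =
        fun S => x a * (f (insert a S) - f S) + ∑ i ∈ A, (f (insert i S) - f S) * x i := by
      funext S
      rw [Finset.sum_insert ha, mul_comm]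
    rw [h1, h2, multilinearExt_add, multilinearExt_const_mul, multilinearExt_sub]
    ring

/-- If the gap to `V` at every set is covered by the marginals weighted by `x`, then the
multilinear extension at `1 - exp (-x)` is at least `(1 - 1 / e) V`. -/
lemma le_multilinearExt_one_sub_exp {A : Finset E} {f : Finset E → ℝ} {x : E → ℝ} {V : ℝ}
    (hx : ∀ i, 0 ≤ x i) (hf : 0 ≤ f ∅)
    (h : ∀ S ⊆ A, V - f S ≤ ∑ i ∈ A, (f (insert i S) - f S) * x i) :
    (1 - 1 / Real.exp 1) * V ≤ multilinearExt A f (fun i => 1 - Real.exp (-x i)) := by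
  set g : ℝ → ℝ := fun s => multilinearExt A f (fun i => 1 - Real.exp (-(s * x i))) with hg
  set g' : ℝ → ℝ := fun s => multilinearExt A (fun S => ∑ i ∈ A, (f (insert i S) - f S) * x i)
        (fun i => 1 - Real.exp (-(s * x i))) with hg'
  have hd : ∀ s, HasDerivAt g (g' s) s := hasDerivAt_multilinearExt A f x
  have hle : ∀ s, 0 ≤ s → V - g s ≤ g' s := by
    intro s hs
    have h1 : V - g s =
        multilinearExt A (fun S => V - f S) (fun i => 1 - Real.exp (-(s * x i))) := by
      rw [multilinearExt_sub, multilinearExt_const]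
    rw [h1]
    refine multilinearExt_mono_fun (fun i => ?_) (fun i => ?_) h
    · rw [sub_nonneg, Real.exp_le_one_iff]
      linarith [mul_nonneg hs (hx i)]
    · linarith [Real.exp_pos (-(s * x i))]
  -- Grönwall with the integrating factor `exp s`: from `g' ≥ V - g` the product is non-decreasing,
  -- and its values at `0` and `1` are compared.
  have hd2 : ∀ s, HasDerivAt (fun s => Real.exp s * (g s - V))
      (Real.exp s * (g s - V) + Real.exp s * g' s) s := fun s =>
    (Real.hasDerivAt_exp s).mul ((hd s).sub_const V)
  have hmono : MonotoneOn (fun s => Real.exp s * (g s - V)) (Set.Icc 0 1) := by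
    refine monotoneOn_of_deriv_nonneg (convex_Icc 0 1)
      (fun s _ => (hd2 s).continuousAt.continuousWithinAt)
      (fun s _ => (hd2 s).differentiableAt.differentiableWithinAt) fun s hs => ?_
    rw [(hd2 s).deriv, ← mul_add]
    rw [interior_Icc] at hs
    exact mul_nonneg (Real.exp_pos s).le (by linarith [hle s hs.1.le])
  have h01 := hmono (Set.left_mem_Icc.2 zero_le_one) (Set.right_mem_Icc.2 zero_le_one) zero_le_one
  have hg0 : 0 ≤ g 0 := by
    have : g 0 = f ∅ := by
      simp only [hg, zero_mul, neg_zero, Real.exp_zero, sub_self]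
      clear * -
      unfold multilinearExt
      rw [Finset.sum_eq_single ∅]
      · simp
      · intro S _ hS
        obtain ⟨i, hi⟩ := Finset.nonempty_iff_ne_empty.2 hS
        rw [Finset.prod_eq_zero hi rfl]
        ring
      · simp
    rw [this]
    exact hf
  have hg1 : g 1 = multilinearExt A f (fun i => 1 - Real.exp (-x i)) := by simp [hg]
  rw [← hg1]
  simp only [Real.exp_zero, one_mul] at h01
  have he := Real.exp_pos 1
  have h2 : Real.exp 1 * ((1 - 1 / Real.exp 1) * V) = Real.exp 1 * V - V := by
    field_simp
  refine le_of_mul_le_mul_left ?_ he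
  rw [h2]
  linarith

end Multilinear

/-! ## The coverage extension at characteristic vectors -/

section StepInput

variable {E : Type*} [DecidableEq E]

/-- Add the elements of `S` one at a time; by submodularity each marginal is at most the marginal at
`U`. -/
lemma StepInput.f_union_le (I : StepInput E) {S U : Finset E} (hS : S ⊆ I.avail)
    (hU : U ⊆ I.avail) : I.f (U ∪ S) ≤ I.f U + ∑ i ∈ S, (I.f (insert i U) - I.f U) := by
  induction S using Finset.induction_on with
  | empty => simp
  | insert a S ha ih =>
    have hS' : S ⊆ I.avail := (Finset.subset_insert _ _).trans hS
    have haA : a ∈ I.avail := hS (Finset.mem_insert_self _ _)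
    rw [Finset.sum_insert ha, Finset.union_insert]
    have h1 := ih hS'
    by_cases hU' : a ∈ U ∪ S
    · rw [Finset.insert_eq_self.2 hU']
      have := I.f_mono _ _ (Finset.subset_insert a U) (Finset.insert_subset haA hU)
      linarith
    · have := I.f_submod U (U ∪ S) Finset.subset_union_left (Finset.union_subset hU hS') a haA hU'
      linarith

lemma StepInput.le_coverage_charVec (I : StepInput E) {S U : Finset E} (hS : S ⊆ I.avail)
    (hU : U ⊆ I.avail) :
    I.f S ≤ I.f U + ∑ i ∈ I.avail, (I.f (insert i U) - I.f U) * charVec S i := by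
  have h1 : ∑ i ∈ I.avail, (I.f (insert i U) - I.f U) * charVec S i =
      ∑ i ∈ S, (I.f (insert i U) - I.f U) := by
    simp only [charVec, mul_ite, mul_one, mul_zero]
    rw [Finset.sum_ite_mem, Finset.inter_eq_right.2 hS]
  rw [h1]
  exact (I.f_mono _ _ Finset.subset_union_right (Finset.union_subset hU hS)).trans
    (I.f_union_le hS hU)

lemma charVec_nonneg (S : Finset E) (i : E) : 0 ≤ charVec S i := by
  unfold charVec; split_ifs <;> norm_num

variable [Fintype E]

lemma StepInput.zeroRow_lhs (i : E) (x : E → ℝ) : (StepInput.zeroRow i).lhs x = x i := by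
  simp [PosRow.lhs, StepInput.zeroRow]

lemma StepInput.wolseyRow_lhs (I : StepInput E) (S : {S // S ∈ I.avail.powerset}) (x : E → ℝ) :
    (I.wolseyRow S).lhs x = ∑ i ∈ I.avail, (I.f (insert i S.1) - I.f S.1) * x i := by
  simp [PosRow.lhs, StepInput.wolseyRow, ite_mul, Finset.sum_ite_mem]

lemma StepInput.wolseyRow_sparsity_le (I : StepInput E) (S : {S // S ∈ I.avail.powerset}) :
    (I.wolseyRow S).sparsity ≤ I.avail.card := by
  unfold PosRow.sparsity
  rw [← Set.ncard_coe_finset]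
  refine Set.ncard_le_ncard (fun i hi => ?_) (Set.toFinite _)
  by_contra h
  have h' : i ∉ I.avail := h
  simp [StepInput.wolseyRow, h'] at hi

lemma StepInput.wolseyBody_sparsity_le (P : PackingPolytope E) (I : StepInput E) :
    (I.wolseyBody P).sparsity ≤ I.avail.card := by
  unfold PositiveBody.sparsity
  refine Finset.sup_le fun r hr => ?_
  obtain ⟨S, rfl⟩ := (Set.Finite.mem_toFinset _).1 hr
  exact I.wolseyRow_sparsity_le S

lemma StepInput.mem_slice_iff (P : PackingPolytope E) (I : StepInput E) (x : E → ℝ) :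
    x ∈ I.slice P ↔ (∀ i, 0 ≤ x i) ∧ ∀ r ∈ (I.wolseyBody P).packing, r.lhs x ≤ r.rhs := by
  constructor
  · rintro ⟨⟨h0, hP⟩, hz⟩
    refine ⟨h0, ?_⟩
    rintro r (hr | ⟨i, hi, rfl⟩)
    · exact hP r hr
    · rw [StepInput.zeroRow_lhs, hz i hi]
      exact le_rfl
  · rintro ⟨h0, hP⟩
    refine ⟨⟨h0, fun r hr => hP r (Or.inl hr)⟩, fun i hi => le_antisymm ?_ (h0 i)⟩
    have := hP _ (Or.inr ⟨i, hi, rfl⟩)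
    rwa [StepInput.zeroRow_lhs] at this

lemma StepInput.wolseyBody_carrier (P : PackingPolytope E) (I : StepInput E) :
    (I.wolseyBody P).carrier = I.slice P ∩ {x | (∀ i, 0 ≤ x i) ∧ I.V ≤ I.fStar x} := by
  ext x
  have hcov : (∀ i, 0 ≤ x i) →
      ((∀ r ∈ (I.wolseyBody P).covering, r.rhs ≤ r.lhs x) ↔ I.V ≤ I.fStar x) := by
    intro h0
    unfold StepInput.fStar coverageExt
    rw [Finset.le_inf'_iff]
    constructor
    · intro h S hS
      have h1 := h _ ⟨⟨S, hS⟩, rfl⟩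
      rw [StepInput.wolseyRow_lhs] at h1
      have h2 : I.V - I.f S ≤ (I.wolseyRow ⟨S, hS⟩).rhs := le_max_left _ _
      linarith
    · rintro h r ⟨S, rfl⟩
      -- Truncating the right-hand side at `0` costs nothing, because the left-hand side is
      -- non-negative at `x ≥ 0`.
      refine max_le ?_ (PosRow.lhs_nonneg _ h0)
      rw [StepInput.wolseyRow_lhs]
      linarith [h S.1 S.2]
  constructor
  · rintro ⟨h0, hc, hp⟩
    exact ⟨(I.mem_slice_iff P x).2 ⟨h0, hp⟩, h0, (hcov h0).1 hc⟩
  · rintro ⟨hs, h0, hV⟩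
    exact ⟨h0, (hcov h0).2 hV, ((I.mem_slice_iff P x).1 hs).2⟩

lemma StepInput.charVec_mem_wolseyBody {P : PackingPolytope E} {I : StepInput E} {S : Finset E}
    (hS : S ⊆ I.avail) (hP : charVec S ∈ I.slice P) (hV : I.V ≤ I.f S) :
    charVec S ∈ (I.wolseyBody P).carrier := by
  rw [StepInput.wolseyBody_carrier]
  refine ⟨hP, charVec_nonneg S, ?_⟩
  unfold StepInput.fStar coverageExt
  rw [Finset.le_inf'_iff]
  exact fun U hU => hV.trans (I.le_coverage_charVec hS (Finset.mem_powerset.1 hU))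

lemma StepInput.exists_feasible_set {P : PackingPolytope E} {I : StepInput E}
    (h : I.V ≤ I.optValue P) :
    ∃ S, S ⊆ I.avail ∧ charVec S ∈ I.slice P ∧ I.V ≤ I.f S := by
  set W : Set ℝ := {v | ∃ S, S ⊆ I.avail ∧ charVec S ∈ I.slice P ∧ v = I.f S} with hW
  have hfin : W.Finite := by
    refine (Set.finite_range I.f).subset ?_
    rintro v ⟨S, -, -, rfl⟩
    exact ⟨S, rfl⟩
  have hne : W.Nonempty := by
    refine ⟨I.f ∅, ∅, Finset.empty_subset _, ?_, rfl⟩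
    have h0 : charVec (∅ : Finset E) = 0 := by
      funext i
      simp [charVec]
    rw [h0]
    exact ⟨⟨fun i => le_rfl, fun r _ => by simpa [PosRow.lhs] using r.rhs_nonneg⟩, fun i _ => rfl⟩
  obtain ⟨S, hS, hSP, hv⟩ := hne.csSup_mem hfin
  exact ⟨S, hS, hSP, hv ▸ h⟩

/-- The multilinear extension at `1 - exp (-x)` for points `x` of the relaxed body. -/
lemma StepInput.le_F_one_sub_exp {P : PackingPolytope E} {I : StepInput E} {ε : ℝ} (hε : 0 < ε)
    {x : E → ℝ} (hx : x ∈ (I.wolseyBody P).relaxed ε) :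
    (1 - 1 / Real.exp 1 - ε) * I.V ≤ I.F (fun i => 1 - Real.exp (-x i)) := by
  obtain ⟨h0, hc, -⟩ := hx
  have hf0 : 0 ≤ I.f ∅ := I.f_nonneg _ (Finset.empty_subset _)
  have he : 0 < 1 / Real.exp 1 := by positivity
  rcases le_or_gt ε 1 with h1 | h1
  · have key : (1 - 1 / Real.exp 1) * ((1 - ε) * I.V) ≤
        I.F (fun i => 1 - Real.exp (-x i)) := by
      -- Target `(1 - ε) V`: the relaxed row covers `(1 - ε)(V - f S)`, which is at least `(1 - ε) V
      -- - f S` as `f S ≥ 0`.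
      refine le_multilinearExt_one_sub_exp h0 hf0 fun S hS => ?_
      have h2 := hc _ ⟨⟨S, Finset.mem_powerset.2 hS⟩, rfl⟩
      rw [StepInput.wolseyRow_lhs] at h2
      have h3 : I.V - I.f S ≤ (I.wolseyRow ⟨S, Finset.mem_powerset.2 hS⟩).rhs := le_max_left _ _
      have h4 := mul_le_mul_of_nonneg_left h3 (sub_nonneg.2 h1)
      nlinarith [mul_nonneg hε.le (I.f_nonneg S hS)]
    nlinarith [mul_nonneg (mul_nonneg he.le hε.le) I.V_nonneg]
  · have h2 : (1 - 1 / Real.exp 1 - ε) * I.V ≤ 0 :=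
      mul_nonpos_of_nonpos_of_nonneg (by linarith) I.V_nonneg
    refine h2.trans (multilinearExt_nonneg (fun i => ?_) (fun i => ?_) I.f_nonneg)
    · rw [sub_nonneg, Real.exp_le_one_iff]
      linarith [h0 i]
    · linarith [Real.exp_pos (-x i)]

end StepInput

/-! ## Chasing positive bodies -/

lemma PositiveBody.row_sparsity_le {E : Type*} (K : PositiveBody E) {r : PosRow E} (hr : r ∈ K.covering) :
    r.sparsity ≤ K.sparsity :=
  Finset.le_sup (f := PosRow.sparsity) ((Set.Finite.mem_toFinset _).2 hr)

section Chaser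

variable {E : Type*} [Fintype E]

/-- The parameter that bounds the truncation levels of the potential. -/
noncomputable def truncLevel (η : ℝ) (d : ℕ) : ℝ := η / (4 * (max 1 d : ℕ))

lemma truncLevel_pos {η : ℝ} (hη : 0 < η) (d : ℕ) : 0 < truncLevel η d := by
  have : (0 : ℝ) < (max 1 d : ℕ) := by exact_mod_cast lt_max_of_lt_left one_pos
  unfold truncLevel
  positivity

lemma truncLevel_anti {η : ℝ} (hη : 0 < η) {d d' : ℕ} (h : d ≤ d') :
    truncLevel η d' ≤ truncLevel η d := by
  have h1 : (0 : ℝ) < (max 1 d : ℕ) := by exact_mod_cast lt_max_of_lt_left one_pos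
  have h2 : ((max 1 d : ℕ) : ℝ) ≤ (max 1 d' : ℕ) := by exact_mod_cast max_le_max le_rfl h
  unfold truncLevel
  gcongr

lemma truncLevel_le {η : ℝ} (hη : 0 < η) (d : ℕ) : truncLevel η d ≤ η / 4 := by
  refine (truncLevel_anti hη (Nat.zero_le d)).trans_eq ?_
  simp [truncLevel]

/-! ### Repairing a point for a single body -/

namespace PositiveBody

/-- Non-negative points that satisfy every constraint of `K` up to a factor `1 ± η`. -/
def approx (K : PositiveBody E) (η : ℝ) : Set (E → ℝ) :=
  {x | (∀ i, 0 ≤ x i) ∧ (∀ r ∈ K.covering, (1 - η) * r.rhs ≤ r.lhs x) ∧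
    ∀ r ∈ K.packing, r.lhs x ≤ (1 + η) * r.rhs}

/-- The move from `x` to `x'` is paid for by the potential against every point of `K`. -/
def Pays (K : PositiveBody E) (η : ℝ) (x x' : E → ℝ) : Prop :=
  ∀ δ, 0 < δ → δ ≤ truncLevel η K.sparsity → ∀ y ∈ K.carrier,
    potential δ x' y + η / 2 * increase x x' ≤ potential δ x y

lemma Pays.refl (K : PositiveBody E) (η : ℝ) (x : E → ℝ) : K.Pays η x x := by
  intro δ _ _ y _
  simp [increase]

lemma Pays.trans {K : PositiveBody E} {η : ℝ} (hη : 0 < η) {x x' x'' : E → ℝ}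
    (h : K.Pays η x x') (h' : K.Pays η x' x'') : K.Pays η x x'' := by
  intro δ hδ hδK y hy
  have h1 := h δ hδ hδK y hy
  have h2 := h' δ hδ hδK y hy
  have h3 := mul_le_mul_of_nonneg_left (increase_triangle x x' x'') (half_pos hη).le
  linarith

/-- The coordinates that the packing constraints with right-hand side `0` force to vanish. -/
def forcedZero (K : PositiveBody E) : Set E :=
  {i | ∃ r ∈ K.packing, r.rhs = 0 ∧ 0 < r.coeff i}

lemma eq_zero_of_mem_forcedZero {K : PositiveBody E} {y : E → ℝ} (hy : y ∈ K.carrier) {i : E}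
    (hi : i ∈ K.forcedZero) : y i = 0 := by
  obtain ⟨r, hr, hr0, hri⟩ := hi
  have h1 : r.lhs y ≤ 0 := hr0 ▸ hy.2.2 r hr
  have h2 : r.coeff i * y i ≤ r.lhs y :=
    Finset.single_le_sum (f := fun i => r.coeff i * y i)
      (fun j _ => mul_nonneg (r.coeff_nonneg j) (hy.1 j)) (Finset.mem_univ i)
  by_contra hne
  have := mul_pos hri (lt_of_le_of_ne (hy.1 i) (Ne.symm hne))
  linarith

lemma exists_step (K : PositiveBody E) {η : ℝ} (hη : 0 < η) (hη1 : η ≤ 1 / 2) :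
    ∃ γ > 0, ∀ x : E → ℝ, (∀ i, 0 ≤ x i) → (∀ i ∈ K.forcedZero, x i = 0) → x ∉ K.approx η →
      ∃ x' : E → ℝ, (∀ i, 0 ≤ x' i) ∧ (∀ i ∈ K.forcedZero, x' i = 0) ∧ K.Pays η x x' ∧
        ∀ y ∈ K.carrier,
          potential (truncLevel η K.sparsity) x' y + γ ≤
            potential (truncLevel η K.sparsity) x y := by
  have hcov : ∀ r ∈ K.covering, ∃ γ > 0, ∀ x : E → ℝ, (∀ i, 0 ≤ x i) →
      (∀ i ∈ K.forcedZero, x i = 0) → r.lhs x < (1 - η) * r.rhs →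
      ∃ x' : E → ℝ, (∀ i, 0 ≤ x' i) ∧ (∀ i ∈ K.forcedZero, x' i = 0) ∧ K.Pays η x x' ∧
        ∀ y ∈ K.carrier,
          potential (truncLevel η K.sparsity) x' y + γ ≤
            potential (truncLevel η K.sparsity) x y := by
    intro r hr
    rcases r.rhs_nonneg.eq_or_lt with h0 | h0
    · refine ⟨1, one_pos, fun x hx _ h => ?_⟩
      rw [← h0, mul_zero] at h
      exact absurd (r.lhs_nonneg hx) (not_le.2 h)
    · obtain ⟨γ, hγ, H⟩ := r.exists_cover_step h0 hη
        ((K.row_sparsity_le hr).trans (le_max_right 1 _)) (le_max_left 1 _) K.forcedZero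
      refine ⟨γ, hγ, fun x hx hxZ h => ?_⟩
      obtain ⟨x', hx', hx'Z, H⟩ := H x hx h
      have H' : ∀ δ, 0 < δ → δ ≤ truncLevel η K.sparsity → ∀ y ∈ K.carrier, _ :=
        fun δ hδ hδK y hy => H δ hδ
          (by linarith [truncLevel_le hη K.sparsity]) hδK y hy.1
          (fun i hi => eq_zero_of_mem_forcedZero hy hi) (hy.2.1 r hr)
      exact ⟨x', hx', fun i hi => (hx'Z i hi).trans (hxZ i hi),
        fun δ hδ hδK y hy => (H' δ hδ hδK y hy).1,
        fun y hy => (H' _ (truncLevel_pos hη _) le_rfl y hy).2⟩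
  have hpack : ∀ r ∈ K.packing, ∃ γ > 0, ∀ x : E → ℝ, (∀ i, 0 ≤ x i) →
      (∀ i ∈ K.forcedZero, x i = 0) → (1 + η) * r.rhs < r.lhs x →
      ∃ x' : E → ℝ, (∀ i, 0 ≤ x' i) ∧ (∀ i ∈ K.forcedZero, x' i = 0) ∧ K.Pays η x x' ∧
        ∀ y ∈ K.carrier,
          potential (truncLevel η K.sparsity) x' y + γ ≤
            potential (truncLevel η K.sparsity) x y := by
    intro r hr
    rcases r.rhs_nonneg.eq_or_lt with h0 | h0
    · refine ⟨1, one_pos, fun x hx hxZ h => ?_⟩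
      have h1 : r.lhs x = 0 := Finset.sum_eq_zero fun i _ => by
        rcases (r.coeff_nonneg i).eq_or_lt with h2 | h2
        · rw [← h2, zero_mul]
        · rw [hxZ i ⟨r, hr, h0.symm, h2⟩, mul_zero]
      rw [h1, ← h0, mul_zero] at h
      exact absurd h (lt_irrefl _)
    · obtain ⟨γ, hγ, H⟩ := r.exists_pack_step h0 hη hη1
      refine ⟨γ, hγ, fun x hx hxZ h => ?_⟩
      obtain ⟨x', hx', hx'x, H⟩ := H x hx h
      have H' : ∀ δ, 0 < δ → δ ≤ truncLevel η K.sparsity → ∀ y ∈ K.carrier, _ :=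
        fun δ hδ hδK y hy => H δ hδ (hδK.trans (truncLevel_le hη _)) y hy.1 (hy.2.2 r hr)
      have hinc : increase x x' = 0 :=
        Finset.sum_eq_zero fun i _ => max_eq_right (sub_nonpos.2 (hx'x i))
      refine ⟨x', hx', fun i hi => le_antisymm ((hx'x i).trans_eq (hxZ i hi)) (hx' i),
        fun δ hδ hδK y hy => ?_,
        fun y hy => H' _ (truncLevel_pos hη _) le_rfl y hy⟩
      rw [hinc]
      linarith [H' δ hδ hδK y hy]
  choose! γc hγc Hc using hcov
  choose! γp hγp Hp using hpack
  -- A common positive lower bound for the gains of the finitely many rows.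
  have hev : ∀ᶠ γ in nhdsWithin (0 : ℝ) (Set.Ioi 0),
      0 < γ ∧ (∀ r ∈ K.covering, γ ≤ γc r) ∧ ∀ r ∈ K.packing, γ ≤ γp r := by
    have hle : ∀ b : ℝ, 0 < b → ∀ᶠ γ in nhdsWithin (0 : ℝ) (Set.Ioi 0), γ ≤ b := fun b hb =>
      Filter.mem_of_superset (Ioc_mem_nhdsGT hb) fun _ h => h.2
    exact (eventually_mem_nhdsWithin).and
      (((Set.Finite.eventually_all K.finite_covering).2 fun r hr => hle _ (hγc r hr)).and
      ((Set.Finite.eventually_all K.finite_packing).2 fun r hr => hle _ (hγp r hr)))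
  obtain ⟨γ, hγ, hγ1, hγ2⟩ := hev.exists
  refine ⟨γ, hγ, fun x hx hxZ hxK => ?_⟩
  by_cases h1 : ∃ r ∈ K.covering, r.lhs x < (1 - η) * r.rhs
  · obtain ⟨r, hr, h1⟩ := h1
    obtain ⟨x', a, b, c, d⟩ := Hc r hr x hx hxZ h1
    exact ⟨x', a, b, c, fun y hy => by linarith [d y hy, hγ1 r hr]⟩
  by_cases h2 : ∃ r ∈ K.packing, (1 + η) * r.rhs < r.lhs x
  · obtain ⟨r, hr, h2⟩ := h2
    obtain ⟨x', a, b, c, d⟩ := Hp r hr x hx hxZ h2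
    exact ⟨x', a, b, c, fun y hy => by linarith [d y hy, hγ2 r hr]⟩
  · push Not at h1 h2
    exact absurd ⟨hx, h1, h2⟩ hxK

/-- From every point one can move, paid for by the potential, to a point that almost satisfies the
constraints of a non-empty body. -/
lemma exists_pays (K : PositiveBody E) (hK : K.carrier.Nonempty) {η : ℝ} (hη : 0 < η)
    (hη1 : η ≤ 1 / 2) {x : E → ℝ} (hx : ∀ i, 0 ≤ x i) : ∃ x' ∈ K.approx η, K.Pays η x x' := by
  classical
  obtain ⟨y, hy⟩ := hK
  obtain ⟨γ, hγ, H⟩ := K.exists_step hη hη1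
  set δ := truncLevel η K.sparsity with hδ
  have hδ0 : 0 < δ := truncLevel_pos hη _
  have hδ1 : δ ≤ 1 := by linarith [truncLevel_le hη K.sparsity]
  -- Termination needs just one point `y` of the body and one level `δ`; with potential at most `n *
  -- γ`, at most `n` updates can occur, as the potential is non-negative.
  have main : ∀ (n : ℕ) (x : E → ℝ), (∀ i, 0 ≤ x i) → (∀ i ∈ K.forcedZero, x i = 0) →
      potential δ x y ≤ n * γ → ∃ x' ∈ K.approx η, K.Pays η x x' := by
    intro n
    induction n with
    | zero =>
      intro x hx hxZ hpot
      by_cases hxK : x ∈ K.approx η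
      · exact ⟨x, hxK, Pays.refl K η x⟩
      · obtain ⟨x', -, -, -, h⟩ := H x hx hxZ hxK
        have h1 := h y hy
        have h2 := potential_nonneg (x := x') hδ0 hδ1 hy.1
        simp only [Nat.cast_zero, zero_mul] at hpot
        linarith
    | succ n ih =>
      intro x hx hxZ hpot
      by_cases hxK : x ∈ K.approx η
      · exact ⟨x, hxK, Pays.refl K η x⟩
      · obtain ⟨x', hx', hx'Z, hpay, h⟩ := H x hx hxZ hxK
        have h1 := h y hy
        push_cast at hpot
        obtain ⟨x'', hx'', hpay'⟩ := ih x' hx' hx'Z (by linarith)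
        exact ⟨x'', hx'', hpay.trans hη hpay'⟩
  -- Zeroing the forced coordinates involves no increase and cannot raise the potential, since `y`
  -- vanishes there.
  set x₀ : E → ℝ := fun i => if i ∈ K.forcedZero then 0 else x i with hx₀
  have hx₀0 : ∀ i, 0 ≤ x₀ i := fun i => by
    simp only [hx₀]
    split_ifs
    · exact le_rfl
    · exact hx i
  have hinc : increase x x₀ = 0 := Finset.sum_eq_zero fun i _ => by
    simp only [hx₀]
    split_ifs
    · simpa using hx i
    · simp
  have hpay : K.Pays η x x₀ := by
    intro δ hδ hδK y hy
    rw [hinc, mul_zero, add_zero]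
    refine Finset.sum_le_sum fun i _ => ?_
    simp only [hx₀]
    split_ifs with h
    · rw [eq_zero_of_mem_forcedZero hy h, truncEntropy_zero_zero]
      exact truncEntropy_nonneg hδ (by linarith [truncLevel_le hη K.sparsity]) le_rfl
    · exact le_rfl
  obtain ⟨n, hn⟩ := exists_nat_ge (potential δ x₀ y / γ)
  obtain ⟨x', hx', hpay'⟩ := main n x₀ hx₀0 (fun i hi => if_pos hi) ((div_le_iff₀ hγ).1 hn)
  exact ⟨x', hx', hpay.trans hη hpay'⟩

open Classical in
/-- One move of the chasing algorithm. -/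
noncomputable def chaseStep (η : ℝ) (x : E → ℝ) (K : PositiveBody E) : E → ℝ :=
  -- For `0 < η ≤ 1/2` and non-negative `x`, the default `0` can occur only at an empty body.
  if h : ∃ x' ∈ K.approx η, K.Pays η x x' then h.choose else 0

lemma chaseStep_spec {K : PositiveBody E} (hK : K.carrier.Nonempty) {η : ℝ} (hη : 0 < η)
    (hη1 : η ≤ 1 / 2) {x : E → ℝ} (hx : ∀ i, 0 ≤ x i) :
    chaseStep η x K ∈ K.approx η ∧ K.Pays η x (chaseStep η x K) := by
  have h := K.exists_pays hK hη hη1 hx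
  unfold chaseStep
  rw [dif_pos h]
  exact h.choose_spec

/-- The chasing algorithm that satisfies all constraints up to a factor `1 ± η`. -/
noncomputable def chase (η : ℝ) : OnlineAlgorithm (PositiveBody E) E :=
  fun h => h.foldl (chaseStep η) 0

end PositiveBody

/-! ### The online run and its recourse -/

lemma history_zero {α : Type*} (I : ℕ → α) : history I 0 = [] := rfl

lemma history_succ {α : Type*} (I : ℕ → α) (t : ℕ) :
    history I (t + 1) = history I t ++ [I (t + 1)] := by
  simp [history, List.range_succ]

lemma history_map {α β : Type*} (f : α → β) (I : ℕ → α) (t : ℕ) :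
    (history I t).map f = history (fun s => f (I s)) t := by
  simp [history]

lemma chase_run_zero (η : ℝ) (K : ℕ → PositiveBody E) : (PositiveBody.chase η).run K 0 = 0 := by
  simp [OnlineAlgorithm.run]

lemma chase_run_succ (η : ℝ) (K : ℕ → PositiveBody E) (t : ℕ) :
    (PositiveBody.chase η).run K (t + 1) =
      PositiveBody.chaseStep η ((PositiveBody.chase η).run K t) (K (t + 1)) := by
  rcases t.eq_zero_or_pos with rfl | ht
  · simp [OnlineAlgorithm.run, PositiveBody.chase, history_succ, history_zero]
  · simp [OnlineAlgorithm.run, PositiveBody.chase, history_succ, ht.ne']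

lemma chase_run_nonneg {η : ℝ} (hη : 0 < η) (hη1 : η ≤ 1 / 2) {T : ℕ} {K : ℕ → PositiveBody E}
    (hK : ∀ t ∈ Finset.Icc 1 T, (K t).carrier.Nonempty) {t : ℕ} (ht : t ≤ T) :
    ∀ i, 0 ≤ (PositiveBody.chase η).run K t i := by
  induction t with
  | zero => rw [chase_run_zero]; exact fun i => le_rfl
  | succ t ih =>
    rw [chase_run_succ]
    exact (PositiveBody.chaseStep_spec (hK _ (Finset.mem_Icc.2 ⟨by omega, ht⟩)) hη hη1
      (ih (by omega))).1.1

lemma chase_run_spec {η : ℝ} (hη : 0 < η) (hη1 : η ≤ 1 / 2) {T : ℕ} {K : ℕ → PositiveBody E}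
    (hK : ∀ t ∈ Finset.Icc 1 T, (K t).carrier.Nonempty) {t : ℕ} (ht : t < T) :
    (PositiveBody.chase η).run K (t + 1) ∈ (K (t + 1)).approx η ∧
      (K (t + 1)).Pays η ((PositiveBody.chase η).run K t)
        ((PositiveBody.chase η).run K (t + 1)) := by
  rw [chase_run_succ]
  exact PositiveBody.chaseStep_spec (hK _ (Finset.mem_Icc.2 ⟨by omega, ht⟩)) hη hη1
    (chase_run_nonneg hη hη1 hK ht.le)

lemma recourse_nonneg (x : ℕ → E → ℝ) (T : ℕ) : 0 ≤ recourse x T :=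
  Finset.sum_nonneg fun _ _ => Finset.sum_nonneg fun _ _ => abs_nonneg _

lemma recourse_zero (T : ℕ) : recourse (fun _ => (0 : E → ℝ)) T = 0 := by simp [recourse]

lemma recourse_smul {σ : ℝ} (hσ : 0 ≤ σ) (x : ℕ → E → ℝ) (T : ℕ) :
    recourse (fun t => σ • x t) T = σ * recourse x T := by
  simp only [recourse, Finset.mul_sum, Pi.smul_apply, smul_eq_mul, ← mul_sub, abs_mul,
    abs_of_nonneg hσ]

/-- The recourse of a non-negative sequence starting at `0` is at most twice its increase. -/
lemma recourse_le_increase {x : ℕ → E → ℝ} (h0 : x 0 = 0) {T : ℕ} (hT : ∀ i, 0 ≤ x T i) :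
    recourse x T ≤ 2 * ∑ t ∈ Finset.range T, increase (x t) (x (t + 1)) := by
  -- `|a| = 2 max(a, 0) - a`, and the last term telescopes to the non-negative total mass at time
  -- `T`.
  have h1 : ∀ t, ∑ i, |x (t + 1) i - x t i| =
      2 * increase (x t) (x (t + 1)) - (∑ i, x (t + 1) i - ∑ i, x t i) := by
    intro t
    unfold increase
    rw [Finset.mul_sum, ← Finset.sum_sub_distrib, ← Finset.sum_sub_distrib]
    refine Finset.sum_congr rfl fun i _ => ?_
    rcases le_total 0 (x (t + 1) i - x t i) with h | h
    · rw [abs_of_nonneg h, max_eq_left h]; ring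
    · rw [abs_of_nonpos h, max_eq_right h]; ring
  unfold recourse
  rw [Finset.sum_congr rfl fun t _ => h1 t, Finset.sum_sub_distrib, ← Finset.mul_sum,
    Finset.sum_range_sub (fun t => ∑ i, x t i), h0]
  have := Finset.sum_nonneg fun i (_ : i ∈ Finset.univ) => hT i
  simp only [Pi.zero_apply, Finset.sum_const_zero, sub_zero]
  linarith

lemma potential_le_add {δ : ℝ} (hδ : 0 < δ) (hδ1 : δ ≤ 1) {x y y' : E → ℝ} (hy : ∀ i, 0 ≤ y i)
    (hy' : ∀ i, 0 ≤ y' i) :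
    potential δ x y' ≤ potential δ x y + Real.log δ⁻¹ * ∑ i, |y' i - y i| := by
  unfold potential
  rw [Finset.mul_sum, ← Finset.sum_add_distrib]
  exact Finset.sum_le_sum fun i _ => truncEntropy_le_add_abs hδ hδ1 (hy i) (hy' i)

/-- The recourse of the chasing algorithm against an offline solution. -/
lemma recourse_chase_le {η : ℝ} (hη : 0 < η) (hη1 : η ≤ 1 / 2) {T : ℕ} {K : ℕ → PositiveBody E}
    (hK : ∀ t ∈ Finset.Icc 1 T, (K t).carrier.Nonempty) {d : ℕ}
    (hd : ∀ t ∈ Finset.Icc 1 T, (K t).sparsity ≤ d) {y : ℕ → E → ℝ} (hy0 : y 0 = 0)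
    (hy : ∀ t ∈ Finset.Icc 1 T, y t ∈ (K t).carrier) :
    recourse ((PositiveBody.chase η).run K) T ≤
      4 / η * Real.log (truncLevel η d)⁻¹ * recourse y T := by
  set x := (PositiveBody.chase η).run K with hx
  set δ := truncLevel η d with hδ
  have hδ0 : 0 < δ := truncLevel_pos hη d
  have hδ1 : δ ≤ 1 := by linarith [truncLevel_le hη d]
  have hypos : ∀ t ≤ T, ∀ i, 0 ≤ y t i := by
    intro t ht
    rcases t.eq_zero_or_pos with rfl | h
    · rw [hy0]; exact fun i => le_rfl
    · exact (hy t (Finset.mem_Icc.2 ⟨h, ht⟩)).1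
  -- Amortization at the level of the overall sparsity bound `d`: the offline move raises the
  -- potential by at most `log δ⁻¹` times its length, then `Pays` charges the online increase to the
  -- potential.
  have hmain : ∀ t ≤ T, potential δ (x t) (y t) +
      η / 2 * ∑ s ∈ Finset.range t, increase (x s) (x (s + 1)) ≤
        Real.log δ⁻¹ * recourse y t := by
    intro t
    induction t with
    | zero =>
      intro _
      rw [hx, chase_run_zero, hy0, potential_zero_zero]
      simp [recourse]
    | succ t ih =>
      intro ht
      have hmem : t + 1 ∈ Finset.Icc 1 T := Finset.mem_Icc.2 ⟨by omega, ht⟩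
      have h1 := ih (by omega)
      have h2 := (chase_run_spec hη hη1 hK (show t < T by omega)).2 δ hδ0
        (truncLevel_anti hη (hd _ hmem)) (y (t + 1)) (hy _ hmem)
      have h3 := potential_le_add (x := x t) hδ0 hδ1 (hypos t (by omega)) (hypos (t + 1) ht)
      have h4 : recourse y (t + 1) = recourse y t + ∑ i, |y (t + 1) i - y t i| := by
        unfold recourse
        rw [Finset.sum_range_succ]
      rw [Finset.sum_range_succ, h4]
      rw [← hx] at h2
      linarith
  have h1 := hmain T le_rfl
  have h2 := potential_nonneg (x := x T) hδ0 hδ1 (hypos T le_rfl)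
  have h3 := recourse_le_increase (x := x) (chase_run_zero η K) (chase_run_nonneg hη hη1 hK le_rfl)
  have h4 : recourse x T ≤ 4 / η * (η / 2 * ∑ s ∈ Finset.range T, increase (x s) (x (s + 1))) := by
    refine h3.trans_eq ?_
    field_simp
    ring
  rw [mul_assoc]
  refine h4.trans (mul_le_mul_of_nonneg_left (by linarith) (by positivity))

/-! ### Calibration of the constants and existence of the chaser -/

lemma ratio_nonneg {C ε : ℝ} (hC : 0 < C) (hε : 0 < ε) (d : ℕ) : 0 ≤ ratio C ε d :=
  mul_nonneg hC.le (mul_nonneg (inv_pos.2 hε).le Real.posLog_nonneg)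

lemma ratio_mono {C ε : ℝ} (hC : 0 < C) (hε : 0 < ε) {d d' : ℕ} (h : d ≤ d') :
    ratio C ε d ≤ ratio C ε d' := by
  have h1 : Real.posLog (d / ε) ≤ Real.posLog (d' / ε) :=
    Real.posLog_le_posLog (by positivity) (by gcongr)
  have := inv_pos.2 hε
  unfold ratio
  gcongr

/-- Internal accuracy and scaling factor for the accuracy `ε`. -/
lemma exists_accuracy_scaling {ε : ℝ} (hε : 0 < ε) :
    ∃ η σ : ℝ, 0 < η ∧ η ≤ 1 / 2 ∧ 0 ≤ σ ∧ σ * (1 + η) ≤ 1 ∧ 1 - ε ≤ σ * (1 - η) ∧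
      ∀ d : ℕ, 1 ≤ d → σ * (4 / η * Real.log (truncLevel η d)⁻¹) ≤ ratio 64 ε d := by
  have htl : ∀ (η : ℝ) (d : ℕ), 1 ≤ d → (truncLevel η d)⁻¹ = 4 * d / η := fun η d hd => by
    unfold truncLevel
    rw [max_eq_right hd, inv_div]
  have hlog2 : Real.log 2 ≤ 3 / 4 := by linarith [Real.log_two_lt_d9]
  rcases le_or_gt ε (1 / 2) with h | h
  -- Here `d / ε ≥ 2`, so the constant in `log (8 d / ε)` is absorbed into `4 log (d / ε)`.
  · refine ⟨ε / 2, (1 + ε / 2)⁻¹, by positivity, by linarith, by positivity, ?_, ?_, ?_⟩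
    · rw [inv_mul_cancel₀ (by positivity)]
    · rw [← div_eq_inv_mul, le_div_iff₀ (by positivity)]
      nlinarith
    · intro d hd
      have hd1 : (1 : ℝ) ≤ d := by exact_mod_cast hd
      have hq : 2 ≤ d / ε := by rw [le_div_iff₀ hε]; linarith
      have h8 : 4 * d / (ε / 2) = 2 ^ 3 * (d / ε) := by field_simp; ring
      have hL : Real.log (4 * d / (ε / 2)) ≤ 4 * Real.log (d / ε) := by
        rw [h8, Real.log_mul (by norm_num) (by positivity), Real.log_pow]
        have := Real.log_le_log two_pos hq
        push_cast
        linarith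
      have hL0 : 0 ≤ Real.log (d / ε) := Real.log_nonneg (by linarith)
      have hσ : (1 + ε / 2)⁻¹ ≤ 1 := inv_le_one_of_one_le₀ (by linarith)
      have hL' : 0 ≤ Real.log (4 * d / (ε / 2)) :=
        Real.log_nonneg (by rw [h8]; linarith)
      rw [htl _ _ hd]
      calc (1 + ε / 2)⁻¹ * (4 / (ε / 2) * Real.log (4 * d / (ε / 2)))
          ≤ 1 * (4 / (ε / 2) * (4 * Real.log (d / ε))) := by gcongr
        _ = 32 * (ε⁻¹ * Real.log (d / ε)) := by field_simp; ring
        _ ≤ 64 * (ε⁻¹ * Real.log (d / ε)) := by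
            have := inv_pos.2 hε
            gcongr
            norm_num
        _ ≤ ratio 64 ε d := by
            unfold ratio
            have := inv_pos.2 hε
            gcongr
            exact le_max_right _ _
  rcases lt_or_ge ε 1 with h1 | h1
  -- For `d = 1` the allowed ratio tends to `0` as `ε → 1`, so the output must shrink as well: `σ`
  -- is chosen with `σ (1 - η) = 1 - ε`, and `1 - ε ≤ -log ε` matches the two rates.
  · refine ⟨1 / 4, 4 * (1 - ε) / 3, by norm_num, by norm_num, by linarith, by linarith,
      by linarith, ?_⟩
    intro d hd
    have hd1 : (1 : ℝ) ≤ d := by exact_mod_cast hd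
    have h16 : 4 * d / (1 / 4) = 2 ^ 4 * (d : ℝ) := by ring
    have hld : 0 ≤ Real.log d := Real.log_nonneg hd1
    have hlε : 1 - ε ≤ -Real.log ε := by linarith [Real.log_le_sub_one_of_pos hε]
    have hq : Real.log (d / ε) = Real.log d - Real.log ε :=
      Real.log_div (by positivity) hε.ne'
    have hL : (1 - ε) * Real.log (4 * d / (1 / 4)) ≤ 3 * Real.log (d / ε) := by
      rw [h16, Real.log_mul (by norm_num) (by positivity), Real.log_pow, hq]
      push_cast
      nlinarith
    have hL0 : 0 ≤ Real.log (d / ε) := by linarith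
    rw [htl _ _ hd]
    calc 4 * (1 - ε) / 3 * (4 / (1 / 4) * Real.log (4 * d / (1 / 4)))
        = 64 / 3 * ((1 - ε) * Real.log (4 * d / (1 / 4))) := by ring
      _ ≤ 64 / 3 * (3 * Real.log (d / ε)) := by gcongr
      _ = 64 * (1 * Real.log (d / ε)) := by ring
      _ ≤ 64 * (ε⁻¹ * Real.log (d / ε)) := by
          have := one_le_inv_iff₀.2 ⟨hε, h1.le⟩
          gcongr
      _ ≤ ratio 64 ε d := by
          unfold ratio
          have := inv_pos.2 hε
          gcongr
          exact le_max_right _ _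
  -- For `ε ≥ 1` the relaxed covering rows are void, and the zero output suffices.
  · refine ⟨1 / 2, 0, by norm_num, le_rfl, le_rfl, by norm_num, by linarith, fun d _ => ?_⟩
    rw [zero_mul]
    exact ratio_nonneg (by norm_num) hε d

lemma le_mul_csInf {s : Set ℝ} (hs : s.Nonempty) {a c : ℝ} (hc : 0 ≤ c)
    (h : ∀ r ∈ s, a ≤ c * r) : a ≤ c * sInf s := by
  rw [← smul_eq_mul, ← Real.sInf_smul_of_nonneg hc]
  refine le_csInf (hs.smul_set) ?_
  rintro _ ⟨r, hr, rfl⟩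
  exact h r hr

/-- At sparsity `0` the competitive ratio is `0`, so no recourse is allowed. Covering rows without
coefficients hold at `0` because they hold at some point. -/
lemma PositiveBody.zero_mem_carrier {K : PositiveBody E} (hK : K.carrier.Nonempty)
    (h : K.sparsity = 0) : (0 : E → ℝ) ∈ K.carrier := by
  obtain ⟨y, hy⟩ := hK
  have h0 : ∀ r : PosRow E, r.lhs 0 = 0 := fun r => by simp [PosRow.lhs]
  refine ⟨fun i => le_rfl, fun r hr => ?_, fun r _ => by rw [h0]; exact r.rhs_nonneg⟩
  have h1 : r.sparsity = 0 := Nat.le_zero.1 (h ▸ K.row_sparsity_le hr)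
  have h2 : ∀ i, r.coeff i = 0 := by
    intro i
    unfold PosRow.sparsity at h1
    rw [Set.ncard_eq_zero (Set.toFinite _)] at h1
    refine le_antisymm (not_lt.1 fun hi => ?_) (r.coeff_nonneg i)
    have : i ∈ {i | 0 < r.coeff i} := hi
    rw [h1] at this
    exact this
  have h3 : r.lhs y = 0 := Finset.sum_eq_zero fun i _ => by rw [h2 i, zero_mul]
  rw [h0, ← h3]
  exact hy.2.1 r hr

/-- Existence of a positive body chasing algorithm. -/
theorem exists_isBodyChaser {ε : ℝ} (hε : 0 < ε) :
    ∃ A : OnlineAlgorithm (PositiveBody E) E, IsBodyChaser 64 ε A := by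
  obtain ⟨η, σ, hη, hη1, hσ, hσ1, hσ2, hrat⟩ := exists_accuracy_scaling hε
  refine ⟨fun h => σ • PositiveBody.chase η h, fun T K hK => ?_⟩
  have hrun : OnlineAlgorithm.run (fun h => σ • PositiveBody.chase η h) K =
      fun t => σ • (PositiveBody.chase η).run K t := by
    funext t
    unfold OnlineAlgorithm.run
    split_ifs <;> simp
  rw [hrun]
  have hlhs : ∀ (r : PosRow E) (x : E → ℝ), r.lhs (σ • x) = σ * r.lhs x := fun r x => by
    simp only [PosRow.lhs, Finset.mul_sum, Pi.smul_apply, smul_eq_mul]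
    exact Finset.sum_congr rfl fun i _ => by ring
  constructor
  · intro t ht
    obtain ⟨h1, h2⟩ := Finset.mem_Icc.1 ht
    obtain ⟨s, rfl⟩ := Nat.exists_eq_add_of_le' h1
    obtain ⟨h0, hc, hp⟩ := (chase_run_spec hη hη1 hK (show s < T by omega)).1
    refine ⟨fun i => mul_nonneg hσ (h0 i), fun r hr => ?_, fun r hr => ?_⟩
    · rw [hlhs]
      have h3 := mul_le_mul_of_nonneg_left (hc r hr) hσ
      have h4 := mul_le_mul_of_nonneg_right hσ2 r.rhs_nonneg
      linarith
    · rw [hlhs]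
      have h3 := mul_le_mul_of_nonneg_left (hp r hr) hσ
      have h4 := mul_le_mul_of_nonneg_right hσ1 r.rhs_nonneg
      linarith
  · rw [recourse_smul hσ]
    set d := (Finset.Icc 1 T).sup fun t => (K t).sparsity with hd
    have hdle : ∀ t ∈ Finset.Icc 1 T, (K t).sparsity ≤ d := fun t ht =>
      Finset.le_sup (f := fun t => (K t).sparsity) ht
    have hr0 := ratio_nonneg (C := 64) (by norm_num) hε d
    unfold bodyOptRecourse
    refine le_mul_csInf ?_ hr0 ?_
    · choose! y hy using hK
      exact ⟨_, fun t => if t = 0 then 0 else y t, if_pos rfl, fun t ht => by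
        simpa [show t ≠ 0 by have := (Finset.mem_Icc.1 ht).1; omega] using hy t ht, rfl⟩
    · rintro _ ⟨y, hy0, hy, rfl⟩
      rcases Nat.eq_zero_or_pos d with h0 | h0
      -- All bodies contain the origin, so comparison with the offline solution that never moves
      -- forces zero recourse.
      · have h1 := recourse_chase_le hη hη1 hK hdle (y := fun _ => 0) rfl fun t ht =>
          PositiveBody.zero_mem_carrier (hK t ht) (Nat.le_zero.1 (h0 ▸ hdle t ht))
        rw [recourse_zero, mul_zero] at h1
        exact (mul_nonpos_of_nonneg_of_nonpos hσ h1).trans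
          (mul_nonneg hr0 (recourse_nonneg _ _))
      · have h1 := recourse_chase_le hη hη1 hK hdle hy0 hy
        calc σ * recourse ((PositiveBody.chase η).run K) T
            ≤ σ * (4 / η * Real.log (truncLevel η d)⁻¹ * recourse y T) := by gcongr
          _ = σ * (4 / η * Real.log (truncLevel η d)⁻¹) * recourse y T := by ring
          _ ≤ _ := mul_le_mul_of_nonneg_right (hrat d h0) (recourse_nonneg _ _)

lemma bodyOptRecourse_nonneg (K : ℕ → PositiveBody E) (T : ℕ) : 0 ≤ bodyOptRecourse K T := by
  refine Real.sInf_nonneg ?_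
  rintro _ ⟨y, -, -, rfl⟩
  exact recourse_nonneg _ _

end Chaser

/-! ## The reduction -/

section Reduction

variable {E : Type*} [Fintype E] [DecidableEq E]

lemma slowChase_run (P : PackingPolytope E) (A : OnlineAlgorithm (PositiveBody E) E)
    (I : ℕ → StepInput E) :
    (slowChase P A).run I = A.run fun t => (I t).wolseyBody P := by
  funext t
  unfold OnlineAlgorithm.run slowChase
  rw [history_map]

lemma StepInput.wolseyBody_nonempty {P : PackingPolytope E} {I : StepInput E}
    (h : I.V ≤ I.optValue P) : (I.wolseyBody P).carrier.Nonempty := by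
  obtain ⟨S, hS, hSP, hV⟩ := StepInput.exists_feasible_set h
  exact ⟨_, StepInput.charVec_mem_wolseyBody hS hSP hV⟩

lemma bodyOptRecourse_le_optRecourse {P : PackingPolytope E} {I : ℕ → StepInput E} {T : ℕ}
    (h : IsInstance P I T) :
    bodyOptRecourse (fun t => (I t).wolseyBody P) T ≤ optRecourse P I T := by
  unfold optRecourse
  refine le_csInf ?_ ?_
  -- Non-emptiness matters: the real infimum of the empty set is `0` by convention.
  · have h' : ∀ t ∈ Finset.Icc 1 T, _ := fun t ht => StepInput.exists_feasible_set (h t ht)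
    choose! S hS using h'
    exact ⟨_, fun t => if t = 0 then ∅ else S t, if_pos rfl, fun t ht => by
      simpa [show t ≠ 0 by have := (Finset.mem_Icc.1 ht).1; omega] using hS t ht, rfl⟩
  · rintro _ ⟨S, hS0, hS, rfl⟩
    refine csInf_le ⟨0, ?_⟩ ⟨fun t => charVec (S t), ?_, fun t ht => ?_, rfl⟩
    · rintro _ ⟨y, -, -, rfl⟩
      exact recourse_nonneg _ _
    · funext i
      simp [hS0, charVec]
    · obtain ⟨h1, h2, h3⟩ := hS t ht
      exact StepInput.charVec_mem_wolseyBody h1 h2 h3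

lemma slowChase_le_F_one_sub_exp {C ε : ℝ} (hε : 0 < ε) (P : PackingPolytope E)
    {A : OnlineAlgorithm (PositiveBody E) E} (hA : IsBodyChaser C ε A) {T : ℕ}
    {I : ℕ → StepInput E} (hI : IsInstance P I T) {t : ℕ} (ht : t ∈ Finset.Icc 1 T) :
    (1 - 1 / Real.exp 1 - ε) * (I t).V ≤
      (I t).F (fun i => 1 - Real.exp (-((slowChase P A).run I t i))) := by
  rw [slowChase_run]
  exact StepInput.le_F_one_sub_exp hε
    ((hA T _ fun t ht => StepInput.wolseyBody_nonempty (hI t ht)).1 t ht)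

lemma isFractionalChaser_slowChase {C ε : ℝ} (hC : 0 < C) (hε : 0 < ε) {P : PackingPolytope E}
    (hP : P.carrier ⊆ Set.Icc 0 1) {A : OnlineAlgorithm (PositiveBody E) E}
    (hA : IsBodyChaser C ε A) :
    IsFractionalChaser P (1 - 1 / Real.exp 1 - ε) (ratio C ε) (slowChase P A) := by
  intro T I hI
  obtain ⟨hfeas, hrec⟩ := hA T (fun t => (I t).wolseyBody P) fun t ht =>
    StepInput.wolseyBody_nonempty (hI t ht)
  constructor
  · intro t ht
    have hF := slowChase_le_F_one_sub_exp hε P hA hI ht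
    rw [slowChase_run] at hF ⊢
    have hmem : A.run (fun t => (I t).wolseyBody P) t ∈ (I t).slice P :=
      ((I t).mem_slice_iff P _).2 ⟨(hfeas t ht).1, (hfeas t ht).2.2⟩
    -- `1 - exp (-x) ≤ x ≤ 1` coordinatewise, the upper bound coming from the polytope lying in the
    -- unit cube.
    refine ⟨hmem, hF.trans (multilinearExt_mono (fun i => ?_) (fun i => ?_) (fun i => ?_)
      (I t).f_mono)⟩
    · rw [sub_nonneg, Real.exp_le_one_iff, neg_nonpos]
      exact (hP hmem.1).1 i
    · linarith [Real.add_one_le_exp (-(A.run (fun t => (I t).wolseyBody P) t i))]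
    · exact (hP hmem.1).2 i
  · rw [slowChase_run]
    refine hrec.trans (mul_le_mul (ratio_mono hC hε ?_) (bodyOptRecourse_le_optRecourse hI)
      (bodyOptRecourse_nonneg _ _) (ratio_nonneg hC hε _))
    exact Finset.sup_mono_fun fun t _ => StepInput.wolseyBody_sparsity_le P (I t)

end Reduction

theorem mainTheorem2 :
    ∃ C : ℝ, 0 < C ∧ ∀ (E : Type*) [Fintype E] [DecidableEq E] (ε : ℝ), 0 < ε →
      -- there is a positive body chasing algorithm to reduce to
      (∃ A : OnlineAlgorithm (PositiveBody E) E, IsBodyChaser C ε A) ∧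
      ∀ P : PackingPolytope E, P.carrier ⊆ Set.Icc 0 1 →
        -- the revealed bodies are non-empty and are `P_t ∩ {x ≥ 0 | f_t^*(x) ≥ V_t}`
        (∀ I : StepInput E, I.V ≤ I.optValue P →
          (I.wolseyBody P).carrier = I.slice P ∩ {x | (∀ i, 0 ≤ x i) ∧ I.V ≤ I.fStar x} ∧
          (I.wolseyBody P).carrier.Nonempty) ∧
        -- the guarantees of the algorithm that chases these bodies
        ∀ A : OnlineAlgorithm (PositiveBody E) E, IsBodyChaser C ε A →
          IsFractionalChaser P (1 - 1 / Real.exp 1 - ε) (ratio C ε) (slowChase P A) ∧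
          ∀ (T : ℕ) (I : ℕ → StepInput E), IsInstance P I T → ∀ t ∈ Finset.Icc 1 T,
            (1 - 1 / Real.exp 1 - ε) * (I t).V ≤
              (I t).F (fun i => 1 - Real.exp (-((slowChase P A).run I t i))) := by
  refine ⟨64, by norm_num, fun E _ _ ε hε => ⟨exists_isBodyChaser hε, fun P hP =>
    ⟨fun I hI => ⟨I.wolseyBody_carrier P, StepInput.wolseyBody_nonempty hI⟩,
      fun A hA => ⟨isFractionalChaser_slowChase (by norm_num) hε hP hA,
        fun T I hI t ht => slowChase_le_F_one_sub_exp hε P hA hI ht⟩⟩⟩⟩
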